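/- Let $V$ be a finite vertex set, let $L$ be a finite set of colors, let $\gamma\notin L$ be a special color, and let $\phi:\binom V2\to L\cup\{\gamma\}$ be an instance of Chromatic Correlation Clustering. A solution is a partition $\mathcal C$ of $V$ into nonempty clusters with a coloring $\Phi:\mathcal C\to L$. Its cost is the number of disagreements, that is, the number of pairs $uv$ with $\phi(uv)=\gamma$ whose end points lie in a common cluster, plus the number of pairs $uv$ with $\phi(uv)\in L$ whose end points do not lie in a common cluster of color $\phi(uv)$. The LP relaxation has variables $x_u^c,x_{uv}^c\in[0,1]$ (for $c\in L$ and distinct $u,v\in V$) and reads \[ \text{minimize}\ \sum_{\phi(uv)\ne\gamma}x_{uv}^{\phi(uv)}+\sum_{\phi(uv)=\gamma}\sum_{c\in L}(1-x_{uv}^c) \quad\text{subject to}\quad x_{uv}^c\ge x_u^c,\,x_v^c,\quad x_{uv}^c+x_{vw}^c\ge x_{wu}^c,\quad \sum_{c\in L}x_u^c=|L|-1 . \] Define rounding functions on $[0,1]$ by $f^-(x)=x$, \[ f^+(x)=\begin{cases}0,&x<0.19,\\ \left(\frac{x-0.19}{0.5095-0.19}\right)^2,&0.19\le x<0.5095,\\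 1,&x\ge 0.5095,\end{cases} \qquad f^\circ(x)=\begin{cases}1.7x,&x<0.5,\\ 0.3x+0.7,&x\ge 0.5.\end{cases} \] LP-Pivot, run on a vertex set $S$ whose pairs carry signs in $\{+,-,\circ\}$ and values $x_{uv}\in[0,1]$, does the following: if $S=\emptyset$, it returns the empty clustering; otherwise it picks a pivot $v\in S$ uniformly at random, forms a cluster $C$ that contains $v$ and, independently, each other $u\in S$ with probability $1-f^{s}(x_{uv})$, where $s$ is the sign of $uv$, and continues recursively on $S\setminus C$. LP-CCC, given a feasible LP solution $x$, puts $S_c=\{u: x_u^c<\tfrac12\}$ for $c\in L$ (these sets are disjoint). Every vertex that lies in no $S_c$ becomes a singleton cluster with an arbitrary color. For each $c\in L$, independently, LP-Pivot is run on $S_c$ with the values $x_{uv}^c$, where $uv$ has sign $+$ if $\phi(uv)=c$, sign $-$ if $\phi(uv)=\gamma$, and sign $\circ$ otherwise, and the resulting clusters receive color $c$. **Theorem.** For every feasible LP solution $x$, LP-CCC always outputs a partition of $V$ into colored clusters, and the expected cost of its output is at most $2.15$ times the LP objective value of $x$. Consequently, if $x$ is an optimal LP solution, LP-CCC is a $2.15$-approximation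 for Chromatic Correlation Clustering: the expected cost of its output is at most $2.15$ times the cost of every solution $(\mathcal C,\Phi)$. -/

import Mathlib

/-! Chromatic correlation clustering on the complete graph with vertex set `V` and colour set `L`.
Edges are the non-diagonal elements of `Sym2 V`. An instance is a map `φ : Sym2 V → Option L`, where
`φ e = some c` means that `e` has colour `c`, and `φ e = none` means that `e` has the special
colour `γ` (the end points should be separated). Values at diagonal elements are never used. -/

namespace CCC

open unitInterval

/-- The edges of the complete graph on `V`. -/
def edges (V : Type*) [Fintype V] [DecidableEq V] : Finset (Sym2 V) :=
  Finset.univ.filter fun e => ¬ e.IsDiag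

/-- A finite set of coloured clusters `(C, c)` is a chromatic clustering of `V` if the clusters are
nonempty and every vertex lies in exactly one of them: the clusters partition `V` and each of
them carries one colour. -/
def IsChromaticClustering {V L : Type*} (K : Finset (Finset V × L)) : Prop :=
  (∀ p ∈ K, p.1.Nonempty) ∧ ∀ u : V, ∃! p, p ∈ K ∧ u ∈ p.1

/-- The edge `e` disagrees with `K`: if `e` has the special colour, its end points are in a common
cluster; if `e` has colour `c`, its end points are not in a common cluster of colour `c`. -/
def Disagrees {V L : Type*} (φ : Sym2 V → Option L) (K : Finset (Finset V × L))
    (e : Sym2 V) : Prop :=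
  match φ e with
  | none => ∃ p ∈ K, ∀ u ∈ e, u ∈ p.1
  | some c => ¬ ∃ p ∈ K, p.2 = c ∧ ∀ u ∈ e, u ∈ p.1

open Classical in
/-- The number of disagreements. -/
noncomputable def cost {V L : Type*} [Fintype V] [DecidableEq V] (φ : Sym2 V → Option L)
    (K : Finset (Finset V × L)) : ℕ :=
  ((edges V).filter fun e => Disagrees φ K e).card

/-! ### The linear programming relaxation -/

/-- The variables of the linear program, with values in `[0, 1]`: `vert u c` is `x_u^c` and
`edge c s(u, v)` is `x_{uv}^c`. -/
structure LPPoint (V L : Type*) where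
  vert : V → L → I
  edge : L → Sym2 V → I

/-- The constraints of the linear program (the bounds `0 ≤ x ≤ 1` are in the type). -/
structure LPPoint.IsFeasible {V L : Type*} [Fintype L] (x : LPPoint V L) : Prop where
  vert_le_edge : ∀ (c : L) (u v : V), u ≠ v → x.vert u c ≤ x.edge c s(u, v)
  triangle : ∀ (c : L) (u v w : V), u ≠ v → v ≠ w → w ≠ u →
    (x.edge c s(w, u) : ℝ) ≤ x.edge c s(u, v) + x.edge c s(v, w)
  sum_vert : ∀ u : V, ∑ c : L, (x.vert u c : ℝ) = (Fintype.card L : ℝ) - 1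

/-- The objective function of the linear program. -/
noncomputable def LPPoint.objective {V L : Type*} [Fintype V] [DecidableEq V] [Fintype L]
    (φ : Sym2 V → Option L) (x : LPPoint V L) : ℝ :=
  ∑ e ∈ edges V,
    match φ e with
    | some c => (x.edge c e : ℝ)
    | none => ∑ c : L, (1 - (x.edge c e : ℝ))

/-- `x` is an optimal solution of the linear program. -/
def LPPoint.IsOptimal {V L : Type*} [Fintype V] [DecidableEq V] [Fintype L]
    (φ : Sym2 V → Option L) (x : LPPoint V L) : Prop :=
  x.IsFeasible ∧ ∀ y : LPPoint V L, y.IsFeasible → x.objective φ ≤ y.objective φ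

/-! ### Finite probability -/

/-- The law of a coin that shows `true` with probability `q`. -/
noncomputable def coin (q : I) : PMF Bool :=
  PMF.ofFintype (fun b => ENNReal.ofReal (if b then (q : ℝ) else 1 - q)) (by
    have h0 := q.2.1
    have h1 := q.2.2
    rw [Fintype.sum_bool, ← ENNReal.ofReal_add] <;> simp [h0, h1])

/-- The joint law of independent random variables with laws `μ i`. -/
noncomputable def indep {ι α : Type*} [Fintype ι] [DecidableEq ι] [Fintype α]
    (μ : ι → PMF α) : PMF (ι → α) :=
  PMF.ofFintype (fun o => ∏ i, μ i (o i)) (by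
    rw [← Fintype.piFinset_univ, ← Finset.prod_univ_sum]
    refine Finset.prod_eq_one fun i _ => ?_
    rw [← tsum_fintype (L := .unconditional _), (μ i).tsum_coe])

/-- The random subset of `S` that contains each `u ∈ S` independently with probability `q u`. -/
noncomputable def randomSubset {V : Type*} [Fintype V] [DecidableEq V] (S : Finset V)
    (q : V → I) : PMF (Finset V) :=
  (indep fun u => coin (q u)).map fun b => S.filter fun u => b u = true

/-- The expectation of `g` under a probability law on a finite type. -/
noncomputable def expectation {α : Type*} [Fintype α] (μ : PMF α) (g : α → ℝ) : ℝ :=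
  ∑ a, (μ a).toReal * g a

/-! ### The algorithms -/

inductive EdgeSign
  | plus
  | minus
  | neutral

/-- `LP-Pivot` on the subgraph induced by `S`, for edge signs `sgn`, rounding functions `f` and
LP values `x`: pick a pivot `v ∈ S` uniformly at random, form the cluster `C` of `v` and of every
other vertex `u ∈ S` independently with probability `1 - p_{uv}`, and recurse on `S \ C`. -/
noncomputable def lpPivot {V : Type*} [Fintype V] [DecidableEq V] (f : EdgeSign → I → I)
    (sgn : Sym2 V → EdgeSign) (x : Sym2 V → I) (S : Finset V) : PMF (Finset (Finset V)) :=
  if h : S.Nonempty then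
    haveI : Nonempty {v // v ∈ S} := h.to_subtype
    (PMF.uniformOfFintype {v // v ∈ S}).bind fun v =>
      (randomSubset (S.erase v) fun u => σ (f (sgn s(u, v)) (x s(u, v)))).bind fun D =>
        (lpPivot f sgn x (S \ insert v.1 D)).map fun 𝒞 => insert (insert v.1 D) 𝒞
  else PMF.pure ∅
termination_by S.card
decreasing_by
  refine Finset.card_lt_card (Finset.ssubset_iff_subset_ne.2 ⟨Finset.sdiff_subset, fun hS => ?_⟩)
  have hv : v.1 ∈ S \ insert v.1 D := hS.symm ▸ v.2
  simp at hv

/-- The rounding function for positive edges. -/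
noncomputable def fPlus (x : ℝ) : ℝ :=
  if x < 0.19 then 0
  else if x < 0.5095 then ((x - 0.19) / (0.5095 - 0.19)) ^ 2
  else 1

/-- The rounding function for negative edges. -/
def fMinus (x : ℝ) : ℝ := x

/-- The rounding function for neutral edges. -/
noncomputable def fNeutral (x : ℝ) : ℝ :=
  if x < 0.5 then 1.7 * x else 0.3 * x + 0.7

theorem fPlus_mem (x : I) : fPlus x ∈ I := by
  unfold fPlus
  split_ifs with h1 h2
  · simp
  · push Not at h1
    have h0 : 0 ≤ ((x : ℝ) - 0.19) / (0.5095 - 0.19) := div_nonneg (by linarith) (by norm_num)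
    have h3 : ((x : ℝ) - 0.19) / (0.5095 - 0.19) ≤ 1 :=
      (div_le_one (by norm_num)).2 (by linarith)
    exact ⟨by positivity, pow_le_one₀ h0 h3⟩
  · simp

theorem fNeutral_mem (x : I) : fNeutral x ∈ I := by
  have h0 := x.2.1
  have h1 := x.2.2
  unfold fNeutral
  split_ifs with h <;> constructor <;> linarith

/-- The three rounding functions as maps `[0, 1] → [0, 1]`. -/
noncomputable def rounding : EdgeSign → I → I
  | .plus, x => ⟨fPlus x, fPlus_mem x⟩
  | .minus, x => ⟨fMinus x, x.2⟩
  | .neutral, x => ⟨fNeutral x, fNeutral_mem x⟩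

open Classical in
/-- The sign of an edge in the class of colour `c`: positive if the edge has colour `c`, negative
if it has the special colour, neutral if it has another colour. -/
noncomputable def signOf {V L : Type*} (φ : Sym2 V → Option L) (c : L) (e : Sym2 V) : EdgeSign :=
  match φ e with
  | none => .minus
  | some d => if d = c then .plus else .neutral

open Classical in
/-- The set `S_c` of the vertices with majority colour `c`, that is, with `x_u^c < 1/2`. -/
noncomputable def colorClass {V L : Type*} [Fintype V] (x : LPPoint V L) (c : L) : Finset V :=
  Finset.univ.filter fun u => (x.vert u c : ℝ) < 1 / 2

open Classical in
/-- `LP-CCC`: the vertices without a majority colour become singletons, with the arbitrary colours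
`a`; `LP-Pivot` runs independently on each class `S_c`, and its clusters receive the colour `c`. -/
noncomputable def lpCCC {V L : Type*} [Fintype V] [DecidableEq V] [Fintype L] [DecidableEq L]
    (φ : Sym2 V → Option L) (x : LPPoint V L) (a : V → L) : PMF (Finset (Finset V × L)) :=
  (indep fun c : L => lpPivot rounding (signOf φ c) (x.edge c) (colorClass x c)).map fun 𝒞 =>
    ((Finset.univ.filter fun u : V => ¬ ∃ c, (x.vert u c : ℝ) < 1 / 2).image fun u => ({u}, a u)) ∪
      Finset.univ.biUnion fun c : L => (𝒞 c).image fun C => (C, c)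

end CCC

/-!
The theorem rests on one inequality for triangles. Fix a colour `c`. In a run of the pivot
algorithm on the class `S_c`, an edge `uv` is decided in the step in which `u` or `v` is
clustered, and its cost is then known. By induction on the remaining vertices
(`expectation_lpPivot_le`) it suffices that in every step the expected cost of the decided edges
is at most `2.15` times their expected LP value. Averaged over the pivot this is a sum over
triples of vertices, so it follows from the nonnegativity of the sum over the three pivots of one
triangle (`tripleBound`), together with the easy case in which the pivot is an end point of the
edge (`pivotSlack_pair_nonneg`).

A neutral edge always disagrees, so everything depends on a good bound for its LP value. If `uv`
has colour `d ≠ c`, then `x_{uv}^d ≥ x_u^d ≥ 1 - x_u^c`, since the numbers `1 - x_u^c` sum to one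
over the colours. As `x_u^c` is at most `1/2` and at most the value of every edge at `u`, and
likewise for `v`, the LP value of a neutral edge in a triangle is at least `1/2` and at least
`1 - y` for the value `y` of each of the three edges (`IsEdgeLP`). The bound `1 - x_{uv}^c` from the
edge alone would not be enough.

There are ten triangles up to symmetry. The slack is affine in the probability with which a
negative or neutral edge joins, so with two positive edges, or with one edge of each sign, only
the extreme values of that edge allowed by the triangle inequality matter, and polynomial
inequalities in two variables remain. With two positive edges in the quadratic range these are
symmetric, and for a fixed sum of the two values worst when both are equal, which leaves one
variable. A positive edge in the range where its rounding function is quadratic is parametrised as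
`0.19 + 0.3195 t` and stays out with probability `t ^ 2`; the slack of a triangle of positive
edges is quasi-concave in `t`, so it can be checked on the boundary, that is, for a degenerate
triangle or an edge at an end of the quadratic range.

Edges inside no colour class cost at most one; only the coloured ones can cost anything, and those
have LP value at least `1/2`. Finally every clustering is an integral point of the linear program
whose objective value is its cost (`objective_integralPoint`).
-/

namespace CCC

open unitInterval

/-! ### The rounding functions -/

/-- The probability that an edge `uv` of sign `s` is decided with a disagreement in a pivot step in
which `u` and `v` independently stay out of the cluster with probabilities `p` and `q`. An edge is
decided once an end point has joined the cluster; a neutral edge then always disagrees. For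
`p, q ∈ {0, 1}` it is the indicator of this event. -/
def decisionCost : EdgeSign → ℝ → ℝ → ℝ
  | .plus, p, q => p + q - 2 * p * q
  | .minus, p, q => (1 - p) * (1 - q)
  | .neutral, p, q => 1 - p * q

theorem fPlus_cases {x : ℝ} :
    (x ≤ 0.19 ∧ fPlus x = 0) ∨
    (∃ t, 0 ≤ t ∧ t ≤ 1 ∧ x = 0.19 + 0.3195 * t ∧ fPlus x = t ^ 2) ∨
    (0.5095 ≤ x ∧ fPlus x = 1) := by
  unfold fPlus
  split_ifs with h1 h2
  · exact Or.inl ⟨h1.le, rfl⟩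
  · push Not at h1
    refine Or.inr (Or.inl ⟨(x - 0.19) / (0.5095 - 0.19), ?_, ?_, ?_, rfl⟩)
    · exact div_nonneg (by linarith) (by norm_num)
    · exact (div_le_one (by norm_num)).2 (by linarith)
    · field_simp; ring
  · exact Or.inr (Or.inr ⟨not_lt.1 h2, rfl⟩)

theorem fNeutral_cases {x : ℝ} :
    (x ≤ 0.5 ∧ fNeutral x = 1.7 * x) ∨ (0.5 ≤ x ∧ fNeutral x = 0.3 * x + 0.7) := by
  unfold fNeutral
  split_ifs with h
  · exact Or.inl ⟨h.le, rfl⟩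
  · exact Or.inr ⟨not_lt.1 h, rfl⟩

theorem fPlus_bounds (x : ℝ) (hx : 0 ≤ x) : 1.15 * fPlus x ≤ 2.15 * x + 0.15 ∧ fPlus x ≤ 2.15 * x ∧
    0 ≤ fPlus x ∧ fPlus x ≤ 1 := by
  rcases fPlus_cases (x := x) with ⟨h, e⟩ | ⟨t, h0, h1, h, e⟩ | ⟨h, e⟩ <;> rw [e]
  · refine ⟨by linarith, by linarith, by norm_num, by norm_num⟩
  · subst h
    refine ⟨by nlinarith, by nlinarith, by positivity, by nlinarith⟩
  · refine ⟨by linarith, by linarith, by norm_num, by norm_num⟩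

/-- This inequality makes the slack of a triangle with two positive edges `x`, `y` increasing in
the probability that the third edge is joined, so that only the longest third edge matters. -/
theorem fPlus_cross_le {x y : ℝ} (hx : 0 ≤ x) (hy : 0 ≤ y) :
    (2 - 2.15 * x) * fPlus y + (2 - 2.15 * y) * fPlus x ≤ 2 := by
  obtain ⟨-, -, p0, p1⟩ := fPlus_bounds x hx
  obtain ⟨-, -, q0, q1⟩ := fPlus_bounds y hy
  rcases fPlus_cases (x := x) with ⟨h, e⟩ | ⟨t, h0, h1, h, e⟩ | ⟨h, e⟩ <;> rw [e] at * <;>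
  rcases fPlus_cases (x := y) with ⟨h', e'⟩ | ⟨u, h0', h1', h', e'⟩ | ⟨h', e'⟩ <;> rw [e'] at *
  · linarith
  · subst h'; nlinarith
  · nlinarith
  · subst h; nlinarith
  · subst h h'
    nlinarith [mul_nonneg h0 h0', mul_nonneg (sub_nonneg.2 h1) (sub_nonneg.2 h1'),
        mul_nonneg h0 (sub_nonneg.2 h1'), mul_nonneg h0' (sub_nonneg.2 h1),
        mul_nonneg (mul_nonneg h0 h0') (sub_nonneg.2 h1'), mul_nonneg (mul_nonneg h0 h0')
        (sub_nonneg.2 h1), sq_nonneg (t - u)]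
  · subst h; nlinarith
  · nlinarith
  · subst h'; nlinarith
  · nlinarith

/-! ### Triangles with at most one positive edge -/

theorem slack_minus_minus_minus {x y z : ℝ} (hx : 0 ≤ x) (hx1 : x ≤ 1) (hy : 0 ≤ y) (hy1 : y ≤ 1)
    (hz : 0 ≤ z) (hz1 : z ≤ 1) :
    0 ≤ (2.15 * (1 - x) * (1 - y * z) - (1 - y) * (1 - z)) +
        (2.15 * (1 - y) * (1 - x * z) - (1 - x) * (1 - z)) +
        (2.15 * (1 - z) * (1 - x * y) - (1 - x) * (1 - y)) := by
  have key : ∀ a b c : ℝ, 0 ≤ a → a ≤ 1 → 0 ≤ b → b ≤ 1 → 0 ≤ c → c ≤ 1 →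
      (1 - a) * (1 - b) ≤ (1 - a) * (1 - b * c) := by
    intro a b c _ _ _ _ _ _
    exact mul_le_mul_of_nonneg_left (by nlinarith) (by linarith)
  have pos : ∀ a b c : ℝ, 0 ≤ a → a ≤ 1 → 0 ≤ b → b ≤ 1 → 0 ≤ c → c ≤ 1 →
      0 ≤ (1 - a) * (1 - b * c) := by
    intro a b c _ _ _ _ _ _
    exact mul_nonneg (by linarith) (by nlinarith)
  have := key x y z hx hx1 hy hy1 hz hz1
  have := key y z x hy hy1 hz hz1 hx hx1
  have := key z x y hz hz1 hx hx1 hy hy1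
  have := pos x y z hx hx1 hy hy1 hz hz1
  have := pos y z x hy hy1 hz hz1 hx hx1
  have := pos z x y hz hz1 hx hx1 hy hy1
  linarith

theorem slack_minus_minus_neutral {x y r l : ℝ} (hx : 0 ≤ x) (hx1 : x ≤ 1) (hy : 0 ≤ y)
    (hy1 : y ≤ 1) (hr : 0 ≤ r) (hr1 : r ≤ 1) (hl : 1 / 2 ≤ l) :
    0 ≤ (2.15 * (1 - x) * (1 - y * r) - (1 - y) * (1 - r)) +
        (2.15 * (1 - y) * (1 - x * r) - (1 - x) * (1 - r)) +
        (2.15 * l * (1 - x * y) - (1 - x * y)) := by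
  have h1 : (1 - x) * (1 - r) ≤ (1 - x) * (1 - y * r) :=
      mul_le_mul_of_nonneg_left (by nlinarith) (by linarith)
  have h2 : (1 - y) * (1 - r) ≤ (1 - y) * (1 - x * r) :=
      mul_le_mul_of_nonneg_left (by nlinarith) (by linarith)
  have h3 : 0 ≤ (1 - x) * (1 - y * r) := mul_nonneg (by linarith) (by nlinarith)
  have h4 : 0 ≤ (1 - y) * (1 - x * r) := mul_nonneg (by linarith) (by nlinarith)
  have h5 : 0 ≤ (2.15 * l - 1) * (1 - x * y) := mul_nonneg (by linarith) (by nlinarith)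
  linarith

theorem slack_neutral_neutral_neutral {p q r l1 l2 l3 : ℝ} (hx : 0 ≤ p) (hx1 : p ≤ 1) (hy : 0 ≤ q)
    (hy1 : q ≤ 1) (hr1 : r ≤ 1) (hl : 1 / 2 ≤ l1) (hl2 : 1 / 2 ≤ l2) (hl3 : 1 / 2 ≤ l3) :
    0 ≤ (2.15 * l1 * (1 - q * r) - (1 - q * r)) + (2.15 * l2 * (1 - p * r) - (1 - p * r)) +
        (2.15 * l3 * (1 - p * q) - (1 - p * q)) := by
  have h5 : 0 ≤ (2.15 * l1 - 1) * (1 - q * r) := mul_nonneg (by linarith) (by nlinarith)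
  have h6 : 0 ≤ (2.15 * l2 - 1) * (1 - p * r) := mul_nonneg (by linarith) (by nlinarith)
  have h7 : 0 ≤ (2.15 * l3 - 1) * (1 - p * q) := mul_nonneg (by linarith) (by nlinarith)
  linarith

theorem slack_plus_minus_minus {x p y z : ℝ} (hx : 0 ≤ x) (hx1 : x ≤ 1) (hp : p = fPlus x)
    (hy1 : y ≤ 1) (hz1 : z ≤ 1) :
    0 ≤ (2.15 * x * (1 - y * z) - (y + z - 2 * y * z)) +
        (2.15 * (1 - y) * (1 - p * z) - (1 - p) * (1 - z)) +
        (2.15 * (1 - z) * (1 - p * y) - (1 - p) * (1 - y)) := by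
  obtain ⟨p2, p3, p0, p1⟩ := fPlus_bounds x hx
  rw [← hp] at p2 p3 p0 p1
  have h1 : 0 ≤ (2.15 * x - 1 + 1.15 * (1 - p)) * ((1 - y) + (1 - z)) :=
      mul_nonneg (by linarith) (by linarith)
  have h2 : 0 ≤ (2 - 2.15 * x + 4.3 * p) := by
    rw [hp]
    rcases fPlus_cases (x := x) with ⟨h, e⟩ | ⟨t, h0, h1, h, e⟩ | ⟨h, e⟩ <;> rw [e] <;> nlinarith
  have h3 := mul_nonneg h2 (mul_nonneg (sub_nonneg.2 hy1) (sub_nonneg.2 hz1))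
  linarith

/-- A short positive edge forces the LP values of the neutral edges up: `1 - x ≤ l₂, l₃`. -/
theorem slack_plus_neutral_neutral {x p q r l2 l3 : ℝ} (hx : 0 ≤ x) (hp0 : 0 ≤ p) (hp1 : p ≤ 1)
    (hy : 0 ≤ q) (hy1 : q ≤ 1) (hr : 0 ≤ r) (hr1 : r ≤ 1) (hl2 : 1 / 2 ≤ l2) (hl3 : 1 / 2 ≤ l3)
    (hl2' : 1 - x ≤ l2) (hl3' : 1 - x ≤ l3) :
    0 ≤ (2.15 * x * (1 - q * r) - (q + r - 2 * q * r)) + (2.15 * l2 * (1 - p * r) - (1 - p * r)) +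
        (2.15 * l3 * (1 - p * q) - (1 - p * q)) := by
  have h2 : 0 ≤ 1 - p * r := by nlinarith
  have h3 : 0 ≤ 1 - p * q := by nlinarith
  have h4 : 0 ≤ 1 - q * r := by nlinarith
  rcases le_total (2.15 * x) 1 with h | h
  · have k2 : 0 ≤ (2.15 * l2 - 2.15 + 2.15 * x) * (1 - p * r) :=
        mul_nonneg (by linarith) (by nlinarith)
    have k3 : 0 ≤ (2.15 * l3 - 2.15 + 2.15 * x) * (1 - p * q) :=
        mul_nonneg (by linarith) (by nlinarith)
    have e1 : 0 ≤ (1.15 - 2.15 * x) * ((1 - p) * (q + r)) :=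
        mul_nonneg (by linarith) (mul_nonneg (by linarith) (by linarith))
    have e2 := mul_nonneg (sub_nonneg.2 hy1) (sub_nonneg.2 hr1)
    have e3 := mul_nonneg (sub_nonneg.2 h) e2
    have e4 : 0 ≤ x * ((1 - q) * (1 - r)) := mul_nonneg hx e2
    linarith
  · have k2 : 0 ≤ (2.15 * l2 - 1) * (1 - p * r) := mul_nonneg (by linarith) (by nlinarith)
    have k3 : 0 ≤ (2.15 * l3 - 1) * (1 - p * q) := mul_nonneg (by linarith) (by nlinarith)
    nlinarith [mul_nonneg hy hr, mul_nonneg (sub_nonneg.2 h) h4,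
        mul_nonneg (sub_nonneg.2 hy1) (sub_nonneg.2 hr1)]

/-! ### Triangles with one negative and two neutral edges -/

/-- Here `m` is a lower bound for `2.15` times the LP values of the neutral edges, minus `1`.
Equality holds for `x = 1` and `y = z = 1/2`; this triangle does not admit a factor smaller than
`2.15`. -/
theorem slack_minus_neutral_neutral_of_le {x y z m : ℝ} (hx : 0 ≤ x) (hx1 : x ≤ 1) (hy : 0 ≤ y)
    (hy1 : y ≤ 1) (hz : 0 ≤ z) (hz1 : z ≤ 1)
    (hxyz : x ≤ y + z) (hyz : y ≤ z) (hm : 0.075 ≤ m) (hmy : 1.15 - 2.15 * y ≤ m) :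
    0 ≤ 2.15 * (1 - x) * (1 - fNeutral y * fNeutral z) - (1 - fNeutral y) * (1 - fNeutral z) +
        m * ((1 - x * fNeutral z) + (1 - x * fNeutral y)) := by
  rcases fNeutral_cases (x := y) with ⟨h, e⟩ | ⟨h, e⟩ <;> rw [e] <;>
  rcases fNeutral_cases (x := z) with ⟨h', e'⟩ | ⟨h', e'⟩ <;> rw [e']
  · have hm' : 0 ≤ m - (1.15 - 2.15 * y) := by linarith
    obtain ⟨u, rfl⟩ : ∃ u, y = 0.5 - u := ⟨0.5 - y, by ring⟩
    obtain ⟨v, rfl⟩ : ∃ v, z = 0.5 - v := ⟨0.5 - z, by ring⟩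
    obtain ⟨w, rfl⟩ : ∃ w, x = 1 - u - v - w := ⟨1 - u - v - x, by ring⟩
    have hu : 0 ≤ u := by linarith
    have hv : 0 ≤ v := by linarith
    have hw : 0 ≤ w := by linarith
    have hvu : 0 ≤ u - v := by linarith
    have hmu : 0 ≤ (m - (0.075 + 2.15 * u)) * (0.3 + 1.7 * (u + v)) :=
        mul_nonneg (by linarith) (by linarith)
    have h1 : 0 ≤ (u + v + w) * (1 - 1.7 * (0.5 - u) * (1.7 * (0.5 - v))) :=
        mul_nonneg (by linarith) (by nlinarith)
    have h2 : 0 ≤ m * ((u + v + w) * (1.7 * (0.5 - u) + 1.7 * (0.5 - v))) :=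
        mul_nonneg (by linarith) (mul_nonneg (by linarith) (by linarith))
    have h3 : 0 ≤ u * v := mul_nonneg hu hv
    nlinarith
  · have hb : 0 ≤ 1 - 1.7 * y := by linarith
    have hc : 0 ≤ 0.3 * (1 - z) := by linarith
    have hm0 : (1 - 1.7 * y) * (0.3 * (1 - z)) ≤ m * ((1 - 1.7 * y) + 0.3 * (1 - z)) := by
      have h3 : 0 ≤ (m - (1.15 - 2.15 * y)) * ((1 - 1.7 * y) + 0.3 * (1 - z)) :=
          mul_nonneg (by linarith) (by linarith)
      have h4 : 0 ≤ (0.5 - y) * (z - 0.5) := mul_nonneg (by linarith) (by linarith)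
      have h5 : 0 ≤ (0.5 - y) * (1 - z) := mul_nonneg (by linarith) (by linarith)
      nlinarith
    have h1 : 0 ≤ (1 - x) * (1 - 1.7 * y * (0.3 * z + 0.7)) :=
        mul_nonneg (by linarith) (by nlinarith)
    have h2 : 0 ≤ m * ((1 - x) * (1.7 * y + (0.3 * z + 0.7))) :=
        mul_nonneg (by linarith) (mul_nonneg (by linarith) (by linarith))
    linarith
  · obtain rfl : y = 0.5 := by linarith
    obtain rfl : z = 0.5 := by linarith
    nlinarith
  · have hm0 : (0.3 * (1 - y)) * (0.3 * (1 - z)) ≤ 0.075 * ((0.3 * (1 - y)) + 0.3 * (1 - z)) := by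
      nlinarith
    have h1 : 0 ≤ (1 - x) * (1 - (0.3 * y + 0.7) * (0.3 * z + 0.7)) :=
        mul_nonneg (by linarith) (by nlinarith)
    have h2 : 0 ≤ m * ((1 - x) * ((0.3 * y + 0.7) + (0.3 * z + 0.7))) :=
        mul_nonneg (by linarith) (mul_nonneg (by linarith) (by linarith))
    have h3 : 0 ≤ (m - 0.075) * ((0.3 * (1 - y)) + 0.3 * (1 - z)) :=
        mul_nonneg (by linarith) (by linarith)
    linarith

/-! ### Triangles with two positive edges and one negative edge -/

/-- The tight case `z = x + y` of two positive and one negative edge on the diagonal `x = y`. -/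
theorem plus_plus_minus_diagonal {τ : ℝ} (h0 : 0 ≤ τ) (h1 : τ ≤ 0.96) :
    0.004 ≤ 1.15 - 4 * (0.19 + 0.3195 * τ) + 2 * (0.19 + 0.3195 * τ) *
        (4 - 4.3 * (0.19 + 0.3195 * τ)) * τ ^ 2 -
        τ ^ 4 * (1 + 2.15 * (1 - 2 * (0.19 + 0.3195 * τ))) := by
  nlinarith [mul_nonneg h0 (sub_nonneg.2 h1), mul_nonneg (mul_nonneg h0 h0) (sub_nonneg.2 h1),
      sq_nonneg (τ ^ 2 - τ), sq_nonneg (τ - 0.96), sq_nonneg (τ - 0.5),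
      mul_nonneg h0 (sq_nonneg (τ - 0.96)), mul_nonneg h0 (sq_nonneg (τ ^ 2 - 0.5))]

theorem plus_plus_minus_tight_of_short {x u : ℝ} (hx : 0 ≤ x) (hx' : x ≤ 0.19) (h0 : 0 ≤ u)
    (h1 : u ≤ 1) :
    0 ≤ 1.15 - 2 * (x + (0.19 + 0.3195 * u)) +
        (x + (0.19 + 0.3195 * u)) * ((2 - 2.15 * x) * u ^ 2 +
            (2 - 2.15 * (0.19 + 0.3195 * u)) * 0) -
      0 * u ^ 2 * (1 + 2.15 * (1 - (x + (0.19 + 0.3195 * u)))) := by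
  have hu : u ^ 2 ≤ 1 := by nlinarith
  have k : 0 ≤ (0.19 - x) * (2 - (2 - 2.15 * (x + 0.19) - 2.15 * (0.19 + 0.3195 * u)) * u ^ 2) := by
    refine mul_nonneg (by linarith) ?_
    nlinarith [mul_nonneg hx (sq_nonneg u), mul_nonneg h0 (sq_nonneg u), sq_nonneg u]
  have k2 : 0 ≤ 0.39 - 0.639 * u + (0.38 + 0.3195 * u) * 1.5915 * u ^ 2 := by
    nlinarith [sq_nonneg (u - 0.5), mul_nonneg h0 (sq_nonneg u)]
  linarith

/-- The slack of two positive edges and a negative edge `z ≤ x + y` is affine and increasing in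
`1 - z`, so it suffices that it is nonnegative for `z = 1` or for `z = x + y`. -/
theorem plus_plus_minus_extremal {x y : ℝ} (hx : 0 ≤ x) (hy : 0 ≤ y) :
    0 ≤ 2.15 * (x + y) - 3 + ((2 - 2.15 * x) * fPlus y + (2 - 2.15 * y) * fPlus x) -
        fPlus x * fPlus y ∨
    0 ≤ 1.15 - 2 * (x + y) + (x + y) * ((2 - 2.15 * x) * fPlus y + (2 - 2.15 * y) * fPlus x) -
        fPlus x * fPlus y * (1 + 2.15 * (1 - (x + y))) := by
  rcases fPlus_cases (x := x) with ⟨h, e⟩ | ⟨t, h0, h1, h, e⟩ | ⟨h, e⟩ <;> rw [e] <;>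
  rcases fPlus_cases (x := y) with ⟨h', e'⟩ | ⟨u, h0', h1', h', e'⟩ | ⟨h', e'⟩ <;> rw [e']
  · right; linarith
  · right; subst h'
    exact plus_plus_minus_tight_of_short hx h h0' h1'
  · left; linarith
  · right; subst h
    have := plus_plus_minus_tight_of_short hy h' h0 h1
    linarith
  · subst h h'
    obtain ⟨τ, d, rfl, rfl⟩ : ∃ τ d, t = τ + d ∧ u = τ - d :=
        ⟨(t + u) / 2, (t - u) / 2, by ring, by ring⟩
    have hE : 0 ≤ d ^ 2 := sq_nonneg d
    have hE' : 0 ≤ τ ^ 2 - d ^ 2 := by nlinarith [mul_nonneg h0 h0']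
    have k1 : 0 ≤ d ^ 2 * (2 * τ ^ 2 - d ^ 2) := mul_nonneg hE (by nlinarith)
    have hτ : 0 ≤ τ := by linarith
    have hτ1 : τ ≤ 1 := by linarith
    -- for fixed `τ` both slacks increase with `d ^ 2`, so the diagonal `d = 0` is the worst case
    have k2 : 0 ≤ d ^ 2 * (4 - 4.3 * (0.19 + 0.3195 * τ) + 8.6 * 0.3195 * τ) :=
        mul_nonneg hE (by linarith)
    rcases le_total τ 0.96 with hc | hc
    · right
      have := plus_plus_minus_diagonal hτ hc
      have k3 := mul_nonneg hτ k2
      have k4 : 0 ≤ (1 - τ) * (d ^ 2 * (2 * τ ^ 2 - d ^ 2)) := mul_nonneg (by linarith) k1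
      linarith
    · left
      have : 0 ≤ 4.3 * (0.19 + 0.3195 * τ) - 3 + (4 - 4.3 * (0.19 + 0.3195 * τ)) * τ ^ 2 -
          τ ^ 4 := by
        nlinarith [mul_nonneg (sub_nonneg.2 hc) (sub_nonneg.2 hτ1),
            mul_nonneg hτ (mul_nonneg (sub_nonneg.2 hc) (sub_nonneg.2 hτ1)),
            mul_nonneg (mul_nonneg hτ hτ) (mul_nonneg (sub_nonneg.2 hc) (sub_nonneg.2 hτ1))]
      linarith
  · left; nlinarith [mul_nonneg h0 (sub_nonneg.2 h1)]
  · left; linarith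
  · left; nlinarith [mul_nonneg h0' (sub_nonneg.2 h1')]
  · left; nlinarith

theorem slack_plus_plus_minus {x y z p q : ℝ} (hx : 0 ≤ x) (hy : 0 ≤ y) (hz1 : z ≤ 1)
    (hz : z ≤ x + y) (hp : p = fPlus x) (hq : q = fPlus y) :
    0 ≤ (2.15 * x * (1 - q * z) - (q + z - 2 * q * z)) +
        (2.15 * y * (1 - p * z) - (p + z - 2 * p * z)) +
        (2.15 * (1 - z) * (1 - p * q) - (1 - p) * (1 - q)) := by
  have K := fPlus_cross_le hx hy
  have C := plus_plus_minus_extremal hx hy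
  obtain ⟨-, -, p0, p1⟩ := fPlus_bounds x hx
  obtain ⟨-, -, q0, q1⟩ := fPlus_bounds y hy
  rw [← hp, ← hq] at *
  have hpq : 0 ≤ 1 - p * q := by nlinarith
  have hs : 0 ≤ 2 + 2.15 - ((2 - 2.15 * x) * q + (2 - 2.15 * y) * p) - 2.15 * (p * q) := by linarith
  rcases C with C | C
  · have := mul_nonneg (sub_nonneg.2 hz1) hs
    linarith
  · have := mul_nonneg (sub_nonneg.2 hz) hs
    linarith

/-! ### Triangles with two positive edges and one neutral edge -/

theorem plus_plus_neutral_of_short {x u m : ℝ} (hx : 0 ≤ x) (hx' : x ≤ 0.19) (h0 : 0 ≤ u)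
    (h1 : u ≤ 1) (hmx : 1.15 - 2.15 * x ≤ m) :
    ∃ c : ℝ, (c = 0 ∨ c = 1 - 1.7 * (x + (0.19 + 0.3195 * u)) ∨
        c = 0.3 * (1 - (x + (0.19 + 0.3195 * u)))) ∧
    0 ≤ c * (2 - (2 - 2.15 * x) * u ^ 2) + 2.15 * (x + (0.19 + 0.3195 * u)) - 2 +
        (1 - 2.15 * x) * u ^ 2 + m := by
  have hu : u ^ 2 ≤ u := by nlinarith
  have hu2 : 0 ≤ u ^ 2 := sq_nonneg u
  rcases le_total (x + (0.19 + 0.3195 * u)) 0.5 with hs | hs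
  · refine ⟨_, Or.inr (Or.inl rfl), ?_⟩
    nlinarith [mul_nonneg hx hu2, mul_nonneg (sub_nonneg.2 hx') hu2, mul_nonneg h0 hu2,
        mul_nonneg (mul_nonneg hx h0) hu2, mul_nonneg hx h0, mul_nonneg (sub_nonneg.2 hx') h0]
  · refine ⟨_, Or.inr (Or.inr rfl), ?_⟩
    nlinarith [mul_nonneg hx hu2, mul_nonneg (sub_nonneg.2 hx') hu2, mul_nonneg h0 hu2,
        mul_nonneg (mul_nonneg hx h0) hu2, mul_nonneg hx h0, mul_nonneg (sub_nonneg.2 hx') h0]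

theorem plus_plus_neutral_diagonal_short {τ : ℝ} (h0 : 0 ≤ τ) (h1 : 0.19 + 0.3195 * τ ≤ 0.25) :
    0 ≤ (1 - 3.4 * (0.19 + 0.3195 * τ)) * (2 - (4 - 4.3 * (0.19 + 0.3195 * τ)) * τ ^ 2) +
        4.3 * (0.19 + 0.3195 * τ) - 2 + (2 - 4.3 * (0.19 + 0.3195 * τ)) * τ ^ 2 +
        (1.15 - 2.15 * (0.19 + 0.3195 * τ)) * (1 - τ ^ 4) := by
  have h2 : 0 ≤ 0.188 - τ := by linarith
  nlinarith [mul_nonneg h0 h2, mul_nonneg (mul_nonneg h0 h0) h2,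
      mul_nonneg (mul_nonneg (mul_nonneg h0 h0) h0) h2,
      mul_nonneg (mul_nonneg (mul_nonneg h0 h0) (mul_nonneg h0 h0)) h2]

theorem plus_plus_neutral_diagonal_middle {τ : ℝ} (h0 : 0.25 ≤ 0.19 + 0.3195 * τ) (h1 : τ ≤ 0.96) :
    0 ≤ (0.3 * (1 - 2 * (0.19 + 0.3195 * τ))) * (2 - (4 - 4.3 * (0.19 + 0.3195 * τ)) * τ ^ 2) +
        4.3 * (0.19 + 0.3195 * τ) - 2 + (2 - 4.3 * (0.19 + 0.3195 * τ)) * τ ^ 2 +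
        (1.15 - 2.15 * (0.19 + 0.3195 * τ)) * (1 - τ ^ 4) := by
  have h2 : 0 ≤ τ - 0.187 := by linarith
  have h3 : 0 ≤ 0.96 - τ := by linarith
  have h4 : 0 ≤ τ := by linarith
  nlinarith [mul_nonneg h2 h3, mul_nonneg h4 (mul_nonneg h2 h3),
      mul_nonneg (mul_nonneg h4 h4) (mul_nonneg h2 h3),
      mul_nonneg (mul_nonneg h4 (mul_nonneg h4 h4)) (mul_nonneg h2 h3)]

theorem plus_plus_neutral_diagonal_long {τ m : ℝ} (h0 : 0.96 ≤ τ) (h1 : τ ≤ 1) (hm : 0.075 ≤ m) :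
    0 ≤ 4.3 * (0.19 + 0.3195 * τ) - 2 + (2 - 4.3 * (0.19 + 0.3195 * τ)) * τ ^ 2 +
        m * (1 - τ ^ 4) := by
  have h2 : 0 ≤ 1 - τ ^ 2 := by nlinarith
  have h3 := mul_nonneg h2 (show 0 ≤ 4.3 * (0.19 + 0.3195 * τ) - 2 + m * (1 + τ ^ 2) by nlinarith)
  linarith

/-- The slack of two positive edges and a neutral edge `z ≤ x + y` is affine and increasing in the
probability of joining the neutral edge. That probability is at least each of the three values
admitted for `c`; one of them suffices. Here `m` is `2.15` times the LP value of the neutral edge,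
minus `1`. -/
theorem plus_plus_neutral_extremal {x y m : ℝ} (hx : 0 ≤ x) (hy : 0 ≤ y) (hm : 0.075 ≤ m)
    (hmx : 1.15 - 2.15 * x ≤ m) (hmy : 1.15 - 2.15 * y ≤ m) :
    ∃ c : ℝ, (c = 0 ∨ c = 1 - 1.7 * (x + y) ∨ c = 0.3 * (1 - (x + y))) ∧
      0 ≤ c * (2 - ((2 - 2.15 * x) * fPlus y + (2 - 2.15 * y) * fPlus x)) + 2.15 * (x + y) - 2 +
          (1 - 2.15 * x) * fPlus y + (1 - 2.15 * y) * fPlus x + m * (1 - fPlus x * fPlus y) := by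
  rcases fPlus_cases (x := x) with ⟨h, e⟩ | ⟨t, h0, h1, h, e⟩ | ⟨h, e⟩ <;> rw [e] <;>
  rcases fPlus_cases (x := y) with ⟨h', e'⟩ | ⟨u, h0', h1', h', e'⟩ | ⟨h', e'⟩ <;> rw [e']
  · exact ⟨_, Or.inr (Or.inl rfl), by linarith⟩
  · subst h'
    obtain ⟨c, hc, h⟩ := plus_plus_neutral_of_short hx h h0' h1' hmx
    exact ⟨c, hc, by linarith⟩
  · exact ⟨_, Or.inl rfl, by linarith⟩
  · subst h
    obtain ⟨c, hc, h⟩ := plus_plus_neutral_of_short hy h' h0 h1 hmy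
    exact ⟨c, by rwa [add_comm _ y], by linarith⟩
  · subst h h'
    obtain ⟨τ, d, rfl, rfl⟩ : ∃ τ d, t = τ + d ∧ u = τ - d :=
        ⟨(t + u) / 2, (t - u) / 2, by ring, by ring⟩
    have hE : 0 ≤ d ^ 2 := sq_nonneg d
    have hE' : 0 ≤ τ ^ 2 - d ^ 2 := by nlinarith [mul_nonneg h0 h0']
    have k1 : 0 ≤ d ^ 2 * (2 * τ ^ 2 - d ^ 2) := mul_nonneg hE (by nlinarith)
    have hτ : 0 ≤ τ := by linarith
    have hτ1 : τ ≤ 1 := by linarith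
    -- for fixed `τ` the slack increases with `d ^ 2`; `0.354` is `c` at the lower end of the range
    have kE : ∀ c : ℝ, c ≤ 0.354 →
        0 ≤ d ^ 2 * (2 * (1 - 2 * c) - (0.817 - 1.37385 * τ) * (1 - c)) :=
      fun c hc => mul_nonneg hE (by nlinarith [mul_nonneg hτ (show 0 ≤ 1 - c by linarith)])
    have km := mul_nonneg (show 0 ≤ m by linarith) k1
    have hτ4 : 0 ≤ 1 - τ ^ 4 := sub_nonneg.2 (pow_le_one₀ hτ hτ1)
    have kM := mul_nonneg (show 0 ≤ m - (1.15 - 2.15 * (0.19 + 0.3195 * τ)) by linarith) hτ4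
    rcases le_total τ 0.96 with hc | hc
    · rcases le_total (0.19 + 0.3195 * τ) 0.25 with hs | hs
      · refine ⟨_, Or.inr (Or.inl rfl), ?_⟩
        have := plus_plus_neutral_diagonal_short hτ hs
        have := kE (1 - 3.4 * (0.19 + 0.3195 * τ)) (by linarith)
        linarith
      · refine ⟨_, Or.inr (Or.inr rfl), ?_⟩
        have := plus_plus_neutral_diagonal_middle hs hc
        have := kE (0.3 * (1 - 2 * (0.19 + 0.3195 * τ))) (by linarith)
        linarith
    · refine ⟨_, Or.inl rfl, ?_⟩
      have := plus_plus_neutral_diagonal_long hc hτ1 hm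
      have := kE 0 (by norm_num)
      linarith
  · refine ⟨_, Or.inl rfl, ?_⟩
    have : 0 ≤ (1 - t ^ 2) * (2.15 * y - 1 + m) := mul_nonneg (by nlinarith) (by linarith)
    linarith
  · exact ⟨_, Or.inl rfl, by linarith⟩
  · refine ⟨_, Or.inl rfl, ?_⟩
    have : 0 ≤ (1 - u ^ 2) * (2.15 * x - 1 + m) := mul_nonneg (by nlinarith) (by linarith)
    linarith
  · exact ⟨_, Or.inl rfl, by linarith⟩

theorem slack_plus_plus_neutral {x y z p q r l : ℝ} (hx : 0 ≤ x) (hy : 0 ≤ y) (hr1 : r ≤ 1)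
    (hz : z ≤ x + y) (hp : p = fPlus x) (hq : q = fPlus y)
    (hrz : r ≤ 1.7 * z) (hrz' : r ≤ 0.3 * z + 0.7) (hl : 1 / 2 ≤ l) (hlx : 1 - x ≤ l)
    (hly : 1 - y ≤ l) :
    0 ≤ (2.15 * x * (1 - q * r) - (q + r - 2 * q * r)) +
        (2.15 * y * (1 - p * r) - (p + r - 2 * p * r)) +
        (2.15 * l * (1 - p * q) - (1 - p * q)) := by
  have K := fPlus_cross_le hx hy
  obtain ⟨c, hc, C⟩ := plus_plus_neutral_extremal (m := 2.15 * l - 1) hx hy (by linarith)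
      (by linarith) (by linarith)
  rw [← hp, ← hq] at *
  have hcr : 0 ≤ 1 - r - c := by rcases hc with rfl | rfl | rfl <;> linarith
  have := mul_nonneg hcr (sub_nonneg.2 K)
  linarith

/-! ### Triangles with one edge of each sign -/

/-- The critical case of one edge of each sign: the negative edge has value `1`, the neutral edge
`1 - x`, with `x` the positive one. The minimum, near `t = 0.9039`, is less than `10⁻⁵`. -/
theorem plus_minus_neutral_critical {t : ℝ} (h0 : 0 ≤ t) (h : 0.19 + 0.3195 * t ≤ 0.5) :
    0 ≤ (2.15 * (0.19 + 0.3195 * t) - 1) * (0.3 * (0.19 + 0.3195 * t)) +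
        (1 - t ^ 2) * (1.15 - 2.45 * (0.19 + 0.3195 * t)) := by
  nlinarith [mul_nonneg h0 (sq_nonneg (t - 0.9039)), sq_nonneg (t - 0.9039)]

theorem plus_minus_neutral_poly {t : ℝ} (h0 : 0 ≤ t) (h : 0.19 + 0.3195 * t ≤ 0.5) :
    0 ≤ (0.5 - (0.19 + 0.3195 * t)) * (1.3 * (2.15 * (0.19 + 0.3195 * t) - 1) + 1.85 * (1 - t ^ 2) +
        0.15 * (2 - 2.15 * (0.19 + 0.3195 * t) + 2.15 * t ^ 2)) +
        0.5 * (1.7 * (2.15 * (0.19 + 0.3195 * t) - 1 - (1 - t ^ 2)) +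
        (2.15 * (0.19 + 0.3195 * t + (1 - t ^ 2)) - 1) +
        0.15 * (2 - 2.15 * (0.19 + 0.3195 * t) + 2.15 * t ^ 2) +
        1.7 * ((0.5 - (0.19 + 0.3195 * t)) * (2 - 2.15 * (0.19 + 0.3195 * t) + 2.15 * t ^ 2))) := by
  have hd := sub_nonneg.2 h
  nlinarith [mul_nonneg h0 hd, mul_nonneg (mul_nonneg h0 h0) hd,
      mul_nonneg (mul_nonneg (mul_nonneg h0 h0) h0) hd]

theorem plus_minus_neutral_of_neutral_short {t z m : ℝ} (h0 : 0 ≤ t) (h1 : t ≤ 1)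
    (hx5 : 0.19 + 0.3195 * t ≤ 0.5) (h' : z ≤ 0.5) (hz : 0 ≤ z)
    (hmx : 1.15 - 2.15 * (0.19 + 0.3195 * t) ≤ m) :
    0 ≤ (2.15 * (0.19 + 0.3195 * t) - 1) * (1 - 1.7 * z) - (1 - t ^ 2) * (1 - 1.7 * z) +
        m * (1 - t ^ 2) + (1 - (0.19 + 0.3195 * t) - z) *
        (2.15 * ((0.19 + 0.3195 * t) + 1 - t ^ 2) - 1 +
        (2 - 2.15 * (0.19 + 0.3195 * t) + 2.15 * t ^ 2) * (1 - 1.7 * z) + m * t ^ 2) := by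
  have hcub := plus_minus_neutral_critical h0 hx5
  obtain ⟨v, rfl⟩ : ∃ v, z = 0.5 - v := ⟨0.5 - z, by ring⟩
  have hv : 0 ≤ v := by linarith
  have hv' : 0 ≤ 0.5 - v := by linarith
  have ha : 0 ≤ 1 - t ^ 2 := by nlinarith
  have hT : 0 ≤ 2 - 2.15 * (0.19 + 0.3195 * t) + 2.15 * t ^ 2 := by nlinarith
  have hd := sub_nonneg.2 hx5
  have k1 := mul_nonneg ha (show 0 ≤ m - (1.15 - 2.15 * (0.19 + 0.3195 * t)) by linarith)
  have k2 := mul_nonneg hd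
    (show 0 ≤ 1.3 * (2.15 * (0.19 + 0.3195 * t) - 1) + 1.85 * (1 - t ^ 2) by nlinarith)
  have k3 := mul_nonneg hd hT
  have k4 := mul_nonneg (mul_nonneg hv hv) hT
  have k5 := mul_nonneg (show 0 ≤ 0.5 - (0.19 + 0.3195 * t) + v by linarith)
      (mul_nonneg (show 0 ≤ m by linarith) (sq_nonneg t))
  have k6 := plus_minus_neutral_poly h0 hx5
  -- the slack dominates an affine function of `v`, nonnegative at the ends `0` and `0.5`
  have k7 := mul_nonneg hv k6
  have k8 := mul_nonneg hv' (add_nonneg k2 (mul_nonneg (show (0:ℝ) ≤ 0.15 by norm_num) k3))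
  linarith

theorem plus_minus_neutral_of_neutral_long {t z m : ℝ} (h0 : 0 ≤ t) (h1 : t ≤ 1)
    (hx5 : 0.19 + 0.3195 * t ≤ 0.5) (hz1 : z ≤ 1) (hmx : 1.15 - 2.15 * (0.19 + 0.3195 * t) ≤ m) :
    0 ≤ (2.15 * (0.19 + 0.3195 * t) - 1) * (1 - (0.3 * z + 0.7)) -
        (1 - t ^ 2) * (1 - (0.3 * z + 0.7)) + m * (1 - t ^ 2) ∨
    0 ≤ (2.15 * (0.19 + 0.3195 * t) - 1) * (1 - (0.3 * z + 0.7)) -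
        (1 - t ^ 2) * (1 - (0.3 * z + 0.7)) + m * (1 - t ^ 2) +
        (1 - (0.19 + 0.3195 * t) - z) * (2.15 * ((0.19 + 0.3195 * t) + 1 - t ^ 2) - 1 +
        (2 - 2.15 * (0.19 + 0.3195 * t) + 2.15 * t ^ 2) * (1 - (0.3 * z + 0.7)) + m * t ^ 2) := by
  have hm' : 0 ≤ m := by linarith
  have ha : 0 ≤ 1 - t ^ 2 := by nlinarith
  have hc1 : 0 ≤ 1 - (0.3 * z + 0.7) := by linarith
  have hcub := plus_minus_neutral_critical h0 hx5
  have k1 := mul_nonneg ha (show 0 ≤ m - (1.15 - 2.15 * (0.19 + 0.3195 * t)) by linarith)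
  rcases le_total z (1 - (0.19 + 0.3195 * t)) with hd | hd
  · right
    have hd := sub_nonneg.2 hd
    have k2 := mul_nonneg hd (mul_nonneg hc1
        (show 0 ≤ 2 - 2.15 * (0.19 + 0.3195 * t) + 2.15 * t ^ 2 by nlinarith))
    have k3 := mul_nonneg hd (mul_nonneg hm' (sq_nonneg t))
    have k4 := mul_nonneg hd (show 0 ≤ 1.3 * (2.15 * (0.19 + 0.3195 * t) - 1) +
        1.85 * (1 - t ^ 2) by nlinarith)
    linarith
  · left
    have hcx : 0 ≤ 0.3 * (0.19 + 0.3195 * t) - (1 - (0.3 * z + 0.7)) := by linarith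
    have k2 := mul_nonneg hc1 (add_nonneg hcub k1)
    have k3 := mul_nonneg hcx (mul_nonneg hm' ha)
    have hx0 : 0 < 0.3 * (0.19 + 0.3195 * t) := by linarith
    refine nonneg_of_mul_nonneg_right ?_ hx0
    linarith

theorem plus_minus_neutral_of_half_le {x t c m : ℝ} (h0 : 0.97 ≤ t) (h1 : t ≤ 1) (hx : 0.5 ≤ x)
    (hc : 0 ≤ c) (hm : 0 ≤ m) :
    0 ≤ (2.15 * x - 1) * c - (1 - t ^ 2) * c + m * (1 - t ^ 2) := by
  have h2 : 1 - t ^ 2 ≤ 0.0591 := by nlinarith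
  have h3 : 0 ≤ 1 - t ^ 2 := by nlinarith
  have := mul_nonneg hc (show 0 ≤ 2.15 * x - 1 - (1 - t ^ 2) by linarith)
  have := mul_nonneg hm h3
  linarith

/-- The slack of a positive edge `x`, a neutral edge `z` and a negative edge `y ≤ x + z` is affine
and increasing in `1 - y`, so it suffices that it is nonnegative for `y = 1` or for `y = x + z`.
Here `c` is the probability of joining the neutral edge, and `m` is `2.15` times its LP value,
minus `1`. -/
theorem plus_minus_neutral_extremal {x z m : ℝ} (hx : 0 ≤ x) (hx1 : x ≤ 1) (hz : 0 ≤ z)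
    (hz1 : z ≤ 1) (hm : 0.075 ≤ m) (hmx : 1.15 - 2.15 * x ≤ m) {p c : ℝ} (hp : p = fPlus x)
    (hc : c = 1 - fNeutral z) :
    0 ≤ (2.15 * x - 1) * c - (1 - p) * c + m * (1 - p) ∨
    0 ≤ (2.15 * x - 1) * c - (1 - p) * c + m * (1 - p) +
        (1 - x - z) * (2.15 * (x + 1 - p) - 1 + (2 - 2.15 * x + 2.15 * p) * c + m * p) := by
  rcases fPlus_cases (x := x) with ⟨h, e⟩ | ⟨t, h0, h1, h, e⟩ | ⟨h, e⟩ <;>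
  rw [e] at hp <;> subst hp <;>
  rcases fNeutral_cases (x := z) with ⟨h', e'⟩ | ⟨h', e'⟩ <;> rw [e'] at hc
  · right
    subst hc
    have k1 := mul_nonneg hx (sub_nonneg.2 h')
    have k2 := mul_nonneg hz (sub_nonneg.2 h)
    have k3 := mul_nonneg (sub_nonneg.2 h') (sub_nonneg.2 h)
    have k4 := mul_nonneg hx hz
    nlinarith [mul_nonneg hx k1, mul_nonneg hz k1, mul_nonneg hz k2, mul_nonneg k2 hx]
  · left
    have : c ≤ 0.15 := by linarith
    have : 0 ≤ c := by linarith
    nlinarith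
  · rcases le_total x 0.5 with hx5 | hx5
    · right
      subst h hc
      exact plus_minus_neutral_of_neutral_short h0 h1 hx5 h' hz hmx
    · exact Or.inl (plus_minus_neutral_of_half_le (by linarith) h1 hx5 (by linarith) (by linarith))
  · rcases le_total x 0.5 with hx5 | hx5
    · subst h hc
      exact plus_minus_neutral_of_neutral_long h0 h1 hx5 hz1 hmx
    · exact Or.inl (plus_minus_neutral_of_half_le (by linarith) h1 hx5 (by linarith) (by linarith))
  · left
    have : 0 ≤ c := by linarith
    nlinarith
  · left
    have : 0 ≤ c := by linarith
    nlinarith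

theorem slack_plus_minus_neutral {x y z p r l : ℝ} (hx : 0 ≤ x) (hx1 : x ≤ 1) (hy1 : y ≤ 1)
    (hz : 0 ≤ z) (hz1 : z ≤ 1) (hyz : y ≤ x + z)
    (hp : p = fPlus x) (hr : r = fNeutral z) (hl : 1 / 2 ≤ l) (hlx : 1 - x ≤ l) :
    0 ≤ (2.15 * x * (1 - y * r) - (y + r - 2 * y * r)) +
        (2.15 * (1 - y) * (1 - p * r) - (1 - p) * (1 - r)) +
        (2.15 * l * (1 - p * y) - (1 - p * y)) := by
  have C := plus_minus_neutral_extremal (m := 2.15 * l - 1) (c := 1 - r) hx hx1 hz hz1 (by linarith)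
      (by linarith) hp (by rw [hr])
  obtain ⟨p2, p3, p0, p1⟩ := fPlus_bounds x hx
  rw [← hp] at p2 p3 p0 p1
  have hr1 : 0 ≤ 1 - r := by
    rcases fNeutral_cases (x := z) with ⟨h, e⟩ | ⟨h, e⟩ <;> rw [hr, e] <;> linarith
  have hT : 0 ≤ 2 - 2.15 * x + 2.15 * p := by
    rw [hp]
    rcases fPlus_cases (x := x) with ⟨h, e⟩ | ⟨t, h0, h1, h, e⟩ | ⟨h, e⟩ <;> rw [e] <;> nlinarith
  have hs : 0 ≤ 2.15 * (x + 1 - p) - 1 + (2 - 2.15 * x + 2.15 * p) * (1 - r) +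
      (2.15 * l - 1) * p := by
    have := mul_nonneg hT hr1
    have := mul_nonneg (show 0 ≤ 2.15 * l - 1 by linarith) p0
    linarith
  rcases C with C | C
  · have := mul_nonneg (sub_nonneg.2 hy1) hs
    linarith
  · have := mul_nonneg (sub_nonneg.2 hyz) hs
    linarith

/-! ### Triangles with three positive edges -/

/-- The excess of `2.15` times the decided LP value over the decided cost, for a triangle of
positive edges with values `x`, `y`, `z` and probabilities `p`, `q`, `r` of staying out. -/
def plusSlack (x y z p q r : ℝ) : ℝ :=
  (2.15 * x * (1 - q * r) - (q + r - 2 * q * r)) + (2.15 * y * (1 - p * r) - (p + r - 2 * p * r)) +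
      (2.15 * z * (1 - p * q) - (p + q - 2 * p * q))

theorem plusSlack_comm₁₂ (x y z p q r : ℝ) : plusSlack x y z p q r = plusSlack y x z q p r := by
  unfold plusSlack; ring

theorem plusSlack_comm₂₃ (x y z p q r : ℝ) : plusSlack x y z p q r = plusSlack x z y p r q := by
  unfold plusSlack; ring

/-- If `A ≥ 0`, then `A v - B v² + C` is quasi-concave on `v ≥ 0`: it is concave or increasing. -/
theorem quad_nonneg_of_endpoints {A B C v v0 v1 : ℝ} (hA : 0 ≤ A) (h0 : 0 ≤ v0) (hv0 : v0 ≤ v)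
    (hv1 : v ≤ v1) (e0 : 0 ≤ A * v0 - B * v0 ^ 2 + C) (e1 : 0 ≤ A * v1 - B * v1 ^ 2 + C) :
    0 ≤ A * v - B * v ^ 2 + C := by
  rcases le_total B 0 with hB | hB
  · have := mul_nonneg hA (sub_nonneg.2 hv0)
    have := mul_nonneg (neg_nonneg.2 hB) (mul_nonneg (sub_nonneg.2 hv0)
        (show 0 ≤ v + v0 by linarith))
    linarith
  · rcases eq_or_lt_of_le (hv0.trans hv1) with h | h
    · obtain rfl : v = v0 := by linarith
      exact e0
    · refine nonneg_of_mul_nonneg_right (a := v1 - v0) ?_ (sub_pos.2 h)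
      have k1 := mul_nonneg (sub_nonneg.2 hv0) e1
      have k2 := mul_nonneg (sub_nonneg.2 hv1) e0
      have k3 := mul_nonneg hB (mul_nonneg (sub_pos.2 h).le
          (mul_nonneg (sub_nonneg.2 hv0) (sub_nonneg.2 hv1)))
      linarith

theorem fPlus_param {t : ℝ} (h0 : 0 ≤ t) (h1 : t ≤ 1) : fPlus (0.19 + 0.3195 * t) = t ^ 2 := by
  unfold fPlus
  rw [if_neg (by linarith)]
  split_ifs with h
  · congr 1
    field_simp
    ring
  · obtain rfl : t = 1 := by linarith
    norm_num

theorem plusSlack_poly_nonneg {t u : ℝ} (h0 : 0 ≤ t) (h1 : t ≤ 1) (h0' : 0 ≤ u) (h1' : u ≤ 1)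
    (h : 0.5095 ≤ 0.38 + 0.3195 * (t + u)) :
    0 ≤ 2.15 * (0.19 + 0.3195 * t) * (1 - u ^ 2) + 2.15 * (0.19 + 0.3195 * u) * (1 - t ^ 2) -
        0.904575 * (1 - t ^ 2 * u ^ 2) := by
  obtain ⟨τ, d, rfl, rfl⟩ : ∃ τ d, t = τ + d ∧ u = τ - d :=
      ⟨(t + u) / 2, (t - u) / 2, by ring, by ring⟩
  have hE : 0 ≤ d ^ 2 := sq_nonneg d
  have hE' : 0 ≤ τ ^ 2 - d ^ 2 := by nlinarith [mul_nonneg h0 h0']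
  have hτ : 0 ≤ τ - 0.2 := by linarith
  have hτ1 : 0 ≤ 1 - τ := by linarith
  have hE1 : 0 ≤ (1 - τ) ^ 2 - d ^ 2 := by
    nlinarith [mul_nonneg (sub_nonneg.2 h1) (sub_nonneg.2 h1')]
  have hE2 : 0 ≤ τ * (1 - τ) - d ^ 2 := by nlinarith [mul_nonneg hτ hE1, mul_nonneg hτ1 hE']
  have key : 0 ≤ 4.3 * (0.19 + 0.3195 * τ) * (1 - τ ^ 2) - 0.904575 * (1 - τ ^ 4) -
      d ^ 2 * (0.817 - 1.37385 * τ + 1.80915 * τ ^ 2) := by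
    have hQ : 0 ≤ 0.817 - 1.37385 * τ + 1.80915 * τ ^ 2 := by nlinarith [sq_nonneg (τ - 0.4)]
    rcases le_total τ 0.7 with hc | hc
    · have hc := sub_nonneg.2 hc
      have k := mul_nonneg hE2 hQ
      have k2 : 0 ≤ (1 - τ) * ((1 + τ) * (4.3 * (0.19 + 0.3195 * τ) - 0.904575 * (1 + τ ^ 2)) -
          τ * (0.817 - 1.37385 * τ + 1.80915 * τ ^ 2)) := by
        refine mul_nonneg hτ1 ?_
        nlinarith [mul_nonneg hτ hc, mul_nonneg hτ (mul_nonneg hτ hc)]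
      linarith
    · have hc := sub_nonneg.2 hc
      have k := mul_nonneg hE1 hQ
      have k2 : 0 ≤ (1 - τ) * ((1 + τ) * (4.3 * (0.19 + 0.3195 * τ) - 0.904575 * (1 + τ ^ 2)) -
          (1 - τ) * (0.817 - 1.37385 * τ + 1.80915 * τ ^ 2)) := by
        refine mul_nonneg hτ1 ?_
        nlinarith [mul_nonneg hτ1 hc, mul_nonneg hτ (mul_nonneg hτ1 hc)]
      linarith
  have := mul_nonneg hE hE
  linarith

/-- One edge is long enough for its end points to be separated with certainty. -/
theorem plusSlack_nonneg_of_long {x y z : ℝ} (hx : 0 ≤ x) (hy : 0 ≤ y) (hz : 0.5095 ≤ z)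
    (hxy : 0.5095 ≤ x + y) : 0 ≤ plusSlack x y z (fPlus x) (fPlus y) 1 := by
  have hAB : ∀ a u : ℝ, 0 ≤ u → u ≤ 1 → 0.5095 ≤ a + (0.19 + 0.3195 * u) →
      0 ≤ 2.15 * a * (1 - u ^ 2) + 2.15 * (0.19 + 0.3195 * u) + 2.15 * z - 2 := by
    intro a u h0 h1 ha
    have k := mul_nonneg (show 0 ≤ 1 - u ^ 2 by nlinarith) (sub_nonneg.2 ha)
    nlinarith [mul_nonneg h0 (sq_nonneg (u - 0.66)), sq_nonneg (u - 0.66)]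
  unfold plusSlack
  rcases fPlus_cases (x := x) with ⟨h, e⟩ | ⟨t, h0, h1, h, e⟩ | ⟨h, e⟩ <;> rw [e] <;>
  rcases fPlus_cases (x := y) with ⟨h', e'⟩ | ⟨u, h0', h1', h', e'⟩ | ⟨h', e'⟩ <;> rw [e']
  · linarith
  · subst h'
    have := hAB x u h0' h1' hxy
    linarith
  · linarith
  · subst h
    have := hAB y t h0 h1 (by linarith)
    linarith
  · subst h h'
    have h2 : 0 ≤ 1 - t ^ 2 := by nlinarith
    have h3 : 0 ≤ 1 - u ^ 2 := by nlinarith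
    have k1 : 0 ≤ (z - 0.5095) * (1 - t ^ 2 * u ^ 2) := mul_nonneg (by linarith) (by nlinarith)
    have key : 0 ≤ 2.15 * (0.19 + 0.3195 * t) * (1 - u ^ 2) +
        2.15 * (0.19 + 0.3195 * u) * (1 - t ^ 2) - 0.904575 * (1 - t ^ 2 * u ^ 2) :=
      plusSlack_poly_nonneg h0 h1 h0' h1' (by linarith)
    linarith
  · have := mul_nonneg (show 0 ≤ 1 - t ^ 2 by nlinarith)
      (show 0 ≤ 2.15 * y + 2.15 * z - 2 by linarith)
    linarith
  · linarith
  · have := mul_nonneg (show 0 ≤ 1 - u ^ 2 by nlinarith)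
      (show 0 ≤ 2.15 * x + 2.15 * z - 2 by linarith)
    linarith
  · linarith

theorem plusSlack_nonneg_of_short_of_le {x u v : ℝ} (hu : 0 ≤ u) (hv1 : v ≤ 1) (huv : u ≤ v)
    (h : (0.19 + 0.3195 * v) ≤ x + (0.19 + 0.3195 * u)) :
    0 ≤ plusSlack x (0.19 + 0.3195 * u) (0.19 + 0.3195 * v) 0 (u ^ 2) (v ^ 2) := by
  have hv : 0 ≤ v := hu.trans huv
  have k1 : 0 ≤ (x - 0.3195 * (v - u)) * (1 - u ^ 2 * v ^ 2) :=
    mul_nonneg (by linarith) (sub_nonneg.2 (mul_le_one₀ (pow_le_one₀ hu (huv.trans hv1))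
        (sq_nonneg v) (pow_le_one₀ hv hv1)))
  -- the maximum over `u` is at `u = 2 * v / 3`
  have k2 : (v - u) * u ^ 2 ≤ 4 / 27 * v ^ 3 := by
    nlinarith [mul_nonneg (show 0 ≤ v + 3 * u by linarith) (sq_nonneg (2 * v - 3 * u))]
  have k3 := mul_le_mul_of_nonneg_left k2 (sq_nonneg v)
  have k4 : 0 ≤ (1 - v ^ 2) * (v ^ 2 - u ^ 2) := mul_nonneg (by nlinarith) (by nlinarith)
  have k5 : 0 ≤ 0.817 + 1.37385 * v - 4 * v ^ 2 + 2 * v ^ 4 - 0.686925 * (4 / 27 * v ^ 5) := by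
    have hv' := sub_nonneg.2 hv1
    nlinarith [sq_nonneg (v ^ 2 - 0.8), sq_nonneg (v - 0.9), mul_nonneg hv hv',
        mul_nonneg (mul_nonneg hv hv) hv', mul_nonneg (mul_nonneg hv (mul_nonneg hv hv)) hv',
        mul_nonneg (mul_nonneg (mul_nonneg hv hv) (mul_nonneg hv hv)) hv']
  unfold plusSlack
  linarith

/-- One edge is joined with certainty, the other two are in the quadratic range. -/
theorem plusSlack_nonneg_of_short {x u v : ℝ} (hu : 0 ≤ u) (hv : 0 ≤ v) (hu1 : u ≤ 1) (hv1 : v ≤ 1)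
    (h : (0.19 + 0.3195 * v) ≤ x + (0.19 + 0.3195 * u))
    (h' : (0.19 + 0.3195 * u) ≤ x + (0.19 + 0.3195 * v)) :
    0 ≤ plusSlack x (0.19 + 0.3195 * u) (0.19 + 0.3195 * v) 0 (u ^ 2) (v ^ 2) := by
  rcases le_total u v with huv | huv
  · exact plusSlack_nonneg_of_short_of_le hu hv1 huv h
  · rw [plusSlack_comm₂₃]
    exact plusSlack_nonneg_of_short_of_le hv hu1 huv h'

/-- The degenerate triangles `z = x + y` in the quadratic range. For a fixed sum `x + y` the slack
is least when `x` is at the lower end `0.19` of the range. -/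
theorem plusSlack_nonneg_of_eq_add {t u v : ℝ} (ht : 0 ≤ t) (hu : 0 ≤ u) (hv1 : v ≤ 1)
    (h : 0.19 + 0.3195 * v = (0.19 + 0.3195 * t) + (0.19 + 0.3195 * u)) :
    0 ≤ plusSlack (0.19 + 0.3195 * t) (0.19 + 0.3195 * u) (0.19 + 0.3195 * v) (t ^ 2) (u ^ 2)
        (v ^ 2) := by
  have hv : 0 ≤ v := by linarith
  -- moving `t` to `0` and `u` to `t + u` keeps the sum
  have A := plusSlack_nonneg_of_short_of_le (x := 0.19) (u := t + u) (v := v)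
      (by linarith) hv1 (by linarith) (by linarith)
  have hP : 0 ≤ t * u := mul_nonneg ht hu
  have hr : v ^ 2 ≤ 1 := pow_le_one₀ hv hv1
  have k1 : 0 ≤ (t * u) * ((0.817 - 0.686925 * (t + u)) * v ^ 2 + 4 * (1 - v ^ 2)) :=
    mul_nonneg hP (add_nonneg (mul_nonneg (by linarith) (sq_nonneg v)) (by linarith))
  have k2 : 0 ≤ (t * u) ^ 2 * (2 - 2.15 * (0.19 + 0.3195 * v)) :=
      mul_nonneg (sq_nonneg _) (by linarith)
  unfold plusSlack at *
  linarith

/-- All three edges are in the quadratic range. As the slack is quasi-concave in `v`, only the end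
points of the interval that the triangle inequalities leave to `v` matter. -/
theorem plusSlack_nonneg_of_middle {t u v : ℝ} (ht : 0 ≤ t) (ht1 : t ≤ 1) (hu : 0 ≤ u) (hu1 : u ≤ 1)
    (hv : 0 ≤ v) (hv1 : v ≤ 1)
    (h1 : (0.19 + 0.3195 * v) ≤ (0.19 + 0.3195 * t) + (0.19 + 0.3195 * u))
    (h2 : (0.19 + 0.3195 * u) ≤ (0.19 + 0.3195 * t) + (0.19 + 0.3195 * v))
    (h3 : (0.19 + 0.3195 * t) ≤ (0.19 + 0.3195 * u) + (0.19 + 0.3195 * v)) :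
    0 ≤ plusSlack (0.19 + 0.3195 * t) (0.19 + 0.3195 * u) (0.19 + 0.3195 * v) (t ^ 2) (u ^ 2)
        (v ^ 2) := by
  have hlin : ∀ w, plusSlack (0.19 + 0.3195 * t) (0.19 + 0.3195 * u) (0.19 + 0.3195 * w) (t ^ 2)
      (u ^ 2) (w ^ 2)
      = (0.686925 * (1 - t ^ 2 * u ^ 2)) * w
        - (2.15 * (0.19 + 0.3195 * t) * u ^ 2 + 2.15 * (0.19 + 0.3195 * u) * t ^ 2 + 2 - 2 * t ^ 2 -
            2 * u ^ 2) * w ^ 2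
        + plusSlack (0.19 + 0.3195 * t) (0.19 + 0.3195 * u) 0.19 (t ^ 2) (u ^ 2) 0 := by
    intro w
    unfold plusSlack
    ring
  have hA : 0 ≤ 0.686925 * (1 - t ^ 2 * u ^ 2) :=
    mul_nonneg (by norm_num) (sub_nonneg.2 (mul_le_one₀ (pow_le_one₀ ht ht1) (sq_nonneg u)
        (pow_le_one₀ hu hu1)))
  -- lower end point: `z = 0.19`, or one of the degenerate triangles `y = x + z`, `x = y + z`
  have hlow : ∃ v0, 0 ≤ v0 ∧ v0 ≤ v ∧ 0 ≤ plusSlack (0.19 + 0.3195 * t) (0.19 + 0.3195 * u)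
      (0.19 + 0.3195 * v0) (t ^ 2) (u ^ 2) (v0 ^ 2) := by
    by_cases ha : 0.19 + 0.3195 * u ≤ 0.19 + (0.19 + 0.3195 * t)
    · by_cases hb : 0.19 + 0.3195 * t ≤ 0.19 + (0.19 + 0.3195 * u)
      · refine ⟨0, le_rfl, hv, ?_⟩
        rw [plusSlack_comm₂₃, plusSlack_comm₁₂]
        simpa using plusSlack_nonneg_of_short (x := 0.19) ht hu ht1 hu1 ha hb
      · refine ⟨t - u - 0.19 / 0.3195, by norm_num at *; linarith, by norm_num at *; linarith, ?_⟩
        rw [plusSlack_comm₁₂, plusSlack_comm₂₃]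
        exact plusSlack_nonneg_of_eq_add hu (by norm_num at *; linarith) ht1 (by ring)
    · refine ⟨u - t - 0.19 / 0.3195, by norm_num at *; linarith, by norm_num at *; linarith, ?_⟩
      rw [plusSlack_comm₂₃]
      exact plusSlack_nonneg_of_eq_add ht (by norm_num at *; linarith) hu1 (by ring)
  -- upper end point: `z = x + y` or `z = 0.5095`
  have hhigh : ∃ v1, v ≤ v1 ∧ 0 ≤ plusSlack (0.19 + 0.3195 * t) (0.19 + 0.3195 * u)
      (0.19 + 0.3195 * v1) (t ^ 2) (u ^ 2) (v1 ^ 2) := by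
    by_cases ha : (0.19 + 0.3195 * t) + (0.19 + 0.3195 * u) ≤ 0.5095
    · refine ⟨t + u + 0.19 / 0.3195, by norm_num at *; linarith, ?_⟩
      exact plusSlack_nonneg_of_eq_add ht hu (by norm_num at *; linarith) (by ring)
    · refine ⟨1, hv1, ?_⟩
      have := plusSlack_nonneg_of_long (x := 0.19 + 0.3195 * t) (y := 0.19 + 0.3195 * u)
          (z := 0.19 + 0.3195 * 1) (by linarith) (by linarith) (by norm_num) (by linarith)
      rw [one_pow]
      rwa [fPlus_param ht ht1, fPlus_param hu hu1] at this
  obtain ⟨v0, hv0, hv0v, e0⟩ := hlow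
  obtain ⟨v1, hvv1, e1⟩ := hhigh
  rw [hlin] at e0 e1 ⊢
  exact quad_nonneg_of_endpoints hA hv0 hv0v hvv1 e0 e1

theorem plusSlack_nonneg {x y z : ℝ} (hx : 0 ≤ x) (hy : 0 ≤ y) (hz : 0 ≤ z) (h1 : x ≤ y + z)
    (h2 : y ≤ x + z) (h3 : z ≤ x + y) :
    0 ≤ plusSlack x y z (fPlus x) (fPlus y) (fPlus z) := by
  have hAAB : ∀ a b w : ℝ, 0 ≤ w → w ≤ 1 → 0.19 + 0.3195 * w ≤ a + b →
      0 ≤ plusSlack a b (0.19 + 0.3195 * w) 0 0 (w ^ 2) := by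
    intro a b w _ _ _
    unfold plusSlack
    nlinarith
  rcases fPlus_cases (x := x) with ⟨hx', e⟩ | ⟨t, ht0, ht1, hx', e⟩ | ⟨hx', e⟩
  · rcases fPlus_cases (x := y) with ⟨hy', e'⟩ | ⟨u, hu0, hu1, hy', e'⟩ | ⟨hy', e'⟩
    · rcases fPlus_cases (x := z) with ⟨hz', e''⟩ | ⟨v, hv0, hv1, hz', e''⟩ | ⟨hz', e''⟩
      · rw [e, e', e'']; unfold plusSlack; linarith
      · rw [e, e', e'', hz']
        exact hAAB _ _ _ hv0 hv1 (by linarith)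
      · linarith
    · rcases fPlus_cases (x := z) with ⟨hz', e''⟩ | ⟨v, hv0, hv1, hz', e''⟩ | ⟨hz', e''⟩
      · rw [e, e', e'', hy', plusSlack_comm₂₃]
        exact hAAB _ _ _ hu0 hu1 (by linarith)
      · rw [e, e', e'', hy', hz']
        exact plusSlack_nonneg_of_short hu0 hv0 hu1 hv1 (by linarith) (by linarith)
      · rw [e'']; exact plusSlack_nonneg_of_long hx hy hz' (by linarith)
    · rw [e', plusSlack_comm₂₃]; exact plusSlack_nonneg_of_long hx hz hy' (by linarith)
  · rcases fPlus_cases (x := y) with ⟨hy', e'⟩ | ⟨u, hu0, hu1, hy', e'⟩ | ⟨hy', e'⟩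
    · rcases fPlus_cases (x := z) with ⟨hz', e''⟩ | ⟨v, hv0, hv1, hz', e''⟩ | ⟨hz', e''⟩
      · rw [e, e', e'', hx', plusSlack_comm₁₂, plusSlack_comm₂₃]
        exact hAAB _ _ _ ht0 ht1 (by linarith)
      · rw [e, e', e'', hx', hz', plusSlack_comm₁₂]
        exact plusSlack_nonneg_of_short ht0 hv0 ht1 hv1 (by linarith) (by linarith)
      · rw [e'']; exact plusSlack_nonneg_of_long hx hy hz' (by linarith)
    · rcases fPlus_cases (x := z) with ⟨hz', e''⟩ | ⟨v, hv0, hv1, hz', e''⟩ | ⟨hz', e''⟩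
      · rw [e, e', e'', hx', hy', plusSlack_comm₂₃, plusSlack_comm₁₂]
        exact plusSlack_nonneg_of_short ht0 hu0 ht1 hu1 (by linarith) (by linarith)
      · rw [e, e', e'', hx', hy', hz']
        exact plusSlack_nonneg_of_middle ht0 ht1 hu0 hu1 hv0 hv1 (by linarith) (by linarith)
            (by linarith)
      · rw [e'']; exact plusSlack_nonneg_of_long hx hy hz' (by linarith)
    · rw [e', plusSlack_comm₂₃]; exact plusSlack_nonneg_of_long hx hz hy' (by linarith)
  · rw [e, plusSlack_comm₁₂, plusSlack_comm₂₃]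
    exact plusSlack_nonneg_of_long hy hz hx' (by linarith)

/-! ### The triangle inequality for all signs -/

/-- `l` is a possible LP value of an edge of sign `s` and value `x` in a triangle whose other edges
have values `y` and `z`. For a neutral edge `l` is the value of the edge in its own colour, which
is at least one half and at least one minus the value of each edge of the triangle. -/
def IsEdgeLP (s : EdgeSign) (l x y z : ℝ) : Prop :=
  match s with
  | .plus => l = x
  | .minus => l = 1 - x
  | .neutral => 1 / 2 ≤ l ∧ 1 - x ≤ l ∧ 1 - y ≤ l ∧ 1 - z ≤ l

/-- The triangle inequality of the analysis: summed over the three choices of the pivot in a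
triangle with signs `s₁`, `s₂`, `s₃`, the cost of the opposite edge is at most `2.15` times the LP
value that is decided with it. -/
def TripleBound (s₁ s₂ s₃ : EdgeSign) : Prop :=
  ∀ (x y z : I) (l₁ l₂ l₃ : ℝ), (x : ℝ) ≤ y + z → (y : ℝ) ≤ x + z → (z : ℝ) ≤ x + y →
    IsEdgeLP s₁ l₁ x y z → IsEdgeLP s₂ l₂ y x z → IsEdgeLP s₃ l₃ z x y →
    0 ≤ (2.15 * l₁ * (1 - rounding s₂ y * rounding s₃ z) -
        decisionCost s₁ (rounding s₂ y) (rounding s₃ z))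
      + (2.15 * l₂ * (1 - rounding s₁ x * rounding s₃ z) -
          decisionCost s₂ (rounding s₁ x) (rounding s₃ z))
      + (2.15 * l₃ * (1 - rounding s₁ x * rounding s₂ y) -
          decisionCost s₃ (rounding s₁ x) (rounding s₂ y))

theorem decisionCost_comm (s : EdgeSign) (p q : ℝ) : decisionCost s p q = decisionCost s q p := by
  cases s <;> simp only [decisionCost] <;> ring

theorem IsEdgeLP.swap {s : EdgeSign} {l x y z : ℝ} (h : IsEdgeLP s l x y z) :
    IsEdgeLP s l x z y := by
  cases s
  · exact h
  · exact h
  · exact ⟨h.1, h.2.1, h.2.2.2, h.2.2.1⟩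

theorem TripleBound.swap₁₂ {s₁ s₂ s₃ : EdgeSign} (h : TripleBound s₁ s₂ s₃) :
    TripleBound s₂ s₁ s₃ := by
  intro x y z l₁ l₂ l₃ h1 h2 h3 e1 e2 e3
  have := h y x z l₂ l₁ l₃ h2 h1 (by linarith) e2 e1 e3.swap
  rw [decisionCost_comm s₃ (rounding s₁ y)] at this
  linarith

theorem TripleBound.swap₂₃ {s₁ s₂ s₃ : EdgeSign} (h : TripleBound s₁ s₂ s₃) :
    TripleBound s₁ s₃ s₂ := by
  intro x y z l₁ l₂ l₃ h1 h2 h3 e1 e2 e3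
  have := h x z y l₁ l₃ l₂ (by linarith) h3 h2 e1.swap e3 e2
  rw [decisionCost_comm s₁ (rounding s₂ z)] at this
  linarith

theorem fNeutral_le {x : ℝ} : fNeutral x ≤ 1.7 * x ∧ fNeutral x ≤ 0.3 * x + 0.7 := by
  rcases fNeutral_cases (x := x) with ⟨h, e⟩ | ⟨h, e⟩ <;> rw [e] <;> constructor <;> linarith

theorem tripleBound_plus_plus_plus : TripleBound .plus .plus .plus := by
  rintro x y z l₁ l₂ l₃ h1 h2 h3 rfl rfl rfl
  exact plusSlack_nonneg x.2.1 y.2.1 z.2.1 h1 h2 h3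

theorem tripleBound_plus_plus_minus : TripleBound .plus .plus .minus := by
  rintro x y z l₁ l₂ l₃ h1 h2 h3 rfl rfl rfl
  exact slack_plus_plus_minus x.2.1 y.2.1 z.2.2 h3 rfl rfl

theorem tripleBound_plus_plus_neutral : TripleBound .plus .plus .neutral := by
  rintro x y z l₁ l₂ l₃ h1 h2 h3 rfl rfl ⟨k1, k2, k3, k4⟩
  exact slack_plus_plus_neutral x.2.1 y.2.1 (fNeutral_mem z).2 h3 rfl rfl fNeutral_le.1
      fNeutral_le.2 k1 k3 k4

theorem tripleBound_plus_minus_minus : TripleBound .plus .minus .minus := by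
  rintro x y z l₁ l₂ l₃ h1 h2 h3 rfl rfl rfl
  exact slack_plus_minus_minus x.2.1 x.2.2 rfl y.2.2 z.2.2

theorem tripleBound_plus_minus_neutral : TripleBound .plus .minus .neutral := by
  rintro x y z l₁ l₂ l₃ h1 h2 h3 rfl rfl ⟨k1, k2, k3, k4⟩
  exact slack_plus_minus_neutral x.2.1 x.2.2 y.2.2 z.2.1 z.2.2 h2 rfl rfl k1 k3

theorem tripleBound_plus_neutral_neutral : TripleBound .plus .neutral .neutral := by
  rintro x y z l₁ l₂ l₃ h1 h2 h3 rfl ⟨k1, k2, k3, k4⟩ ⟨m1, m2, m3, m4⟩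
  exact slack_plus_neutral_neutral x.2.1 (fPlus_mem x).1 (fPlus_mem x).2 (fNeutral_mem y).1
      (fNeutral_mem y).2 (fNeutral_mem z).1 (fNeutral_mem z).2 k1 m1 k3 m3

theorem tripleBound_minus_minus_minus : TripleBound .minus .minus .minus := by
  rintro x y z l₁ l₂ l₃ h1 h2 h3 rfl rfl rfl
  exact slack_minus_minus_minus x.2.1 x.2.2 y.2.1 y.2.2 z.2.1 z.2.2

theorem tripleBound_minus_minus_neutral : TripleBound .minus .minus .neutral := by
  rintro x y z l₁ l₂ l₃ h1 h2 h3 rfl rfl ⟨k1, k2, k3, k4⟩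
  exact slack_minus_minus_neutral x.2.1 x.2.2 y.2.1 y.2.2 (fNeutral_mem z).1 (fNeutral_mem z).2 k1

theorem tripleBound_minus_neutral_neutral : TripleBound .minus .neutral .neutral := by
  rintro x y z l₁ l₂ l₃ h1 h2 h3 rfl ⟨k1, k2, k3, k4⟩ ⟨m1, m2, m3, m4⟩
  simp only [rounding, decisionCost, fMinus]
  have hx := x.2
  have hr := fNeutral_mem z
  have hq := fNeutral_mem y
  have a1 : 0 ≤ 1 - (x : ℝ) * fNeutral z := sub_nonneg.2 (mul_le_one₀ hx.2 hr.1 hr.2)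
  have a2 : 0 ≤ 1 - (x : ℝ) * fNeutral y := sub_nonneg.2 (mul_le_one₀ hx.2 hq.1 hq.2)
  -- `m` comes from the smaller of the LP values of the two neutral edges
  obtain ⟨m, hm, hmy, hmz, n2, n3⟩ : ∃ m : ℝ, 0.075 ≤ m ∧ 1.15 - 2.15 * (y : ℝ) ≤ m ∧
      1.15 - 2.15 * (z : ℝ) ≤ m ∧ m ≤ 2.15 * l₂ - 1 ∧ m ≤ 2.15 * l₃ - 1 :=
    ⟨2.15 * min l₂ l₃ - 1, by linarith [le_min k1 m1], by linarith [le_min k2 m4],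
      by linarith [le_min k4 m2], by linarith [min_le_left l₂ l₃],
      by linarith [min_le_right l₂ l₃]⟩
  have b1 := mul_nonneg (sub_nonneg.2 n2) a1
  have b2 := mul_nonneg (sub_nonneg.2 n3) a2
  rcases le_total (y : ℝ) z with hyz | hyz
  · have := slack_minus_neutral_neutral_of_le hx.1 hx.2 y.2.1 y.2.2 z.2.1 z.2.2 h1 hyz hm hmy
    linarith
  · have := slack_minus_neutral_neutral_of_le hx.1 hx.2 z.2.1 z.2.2 y.2.1 y.2.2
        (by linarith) hyz hm hmz
    linarith

theorem tripleBound_neutral_neutral_neutral : TripleBound .neutral .neutral .neutral := by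
  rintro x y z l₁ l₂ l₃ h1 h2 h3 ⟨k1, -⟩ ⟨k2, -⟩ ⟨k3, -⟩
  exact slack_neutral_neutral_neutral (fNeutral_mem x).1 (fNeutral_mem x).2 (fNeutral_mem y).1
      (fNeutral_mem y).2 (fNeutral_mem z).2 k1 k2 k3

theorem tripleBound (s₁ s₂ s₃ : EdgeSign) : TripleBound s₁ s₂ s₃ := by
  cases s₁ <;> cases s₂ <;> cases s₃
  · exact tripleBound_plus_plus_plus
  · exact tripleBound_plus_plus_minus
  · exact tripleBound_plus_plus_neutral
  · exact tripleBound_plus_plus_minus.swap₂₃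
  · exact tripleBound_plus_minus_minus
  · exact tripleBound_plus_minus_neutral
  · exact tripleBound_plus_plus_neutral.swap₂₃
  · exact tripleBound_plus_minus_neutral.swap₂₃
  · exact tripleBound_plus_neutral_neutral
  · exact tripleBound_plus_plus_minus.swap₂₃.swap₁₂
  · exact tripleBound_plus_minus_minus.swap₁₂
  · exact tripleBound_plus_minus_neutral.swap₁₂
  · exact tripleBound_plus_minus_minus.swap₁₂.swap₂₃
  · exact tripleBound_minus_minus_minus
  · exact tripleBound_minus_minus_neutral
  · exact tripleBound_plus_minus_neutral.swap₁₂.swap₂₃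
  · exact tripleBound_minus_minus_neutral.swap₂₃
  · exact tripleBound_minus_neutral_neutral
  · exact tripleBound_plus_plus_neutral.swap₂₃.swap₁₂
  · exact tripleBound_plus_minus_neutral.swap₂₃.swap₁₂
  · exact tripleBound_plus_neutral_neutral.swap₁₂
  · exact tripleBound_plus_minus_neutral.swap₂₃.swap₁₂.swap₂₃
  · exact tripleBound_minus_minus_neutral.swap₂₃.swap₁₂
  · exact tripleBound_minus_neutral_neutral.swap₁₂
  · exact tripleBound_plus_neutral_neutral.swap₁₂.swap₂₃
  · exact tripleBound_minus_neutral_neutral.swap₁₂.swap₂₃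
  · exact tripleBound_neutral_neutral_neutral

/-! ### Expectations over finite types -/

section Expectation
variable {α β : Type*} [Fintype α] [Fintype β]

theorem expectation_bind (μ : PMF α) (κ : α → PMF β) (g : β → ℝ) :
    expectation (μ.bind κ) g = expectation μ fun a => expectation (κ a) g := by
  unfold expectation
  simp_rw [PMF.bind_apply, tsum_fintype, Finset.mul_sum, ← mul_assoc]
  rw [Finset.sum_comm]
  refine Finset.sum_congr rfl fun b _ => ?_
  rw [ENNReal.toReal_sum fun a _ => ENNReal.mul_ne_top (μ.apply_ne_top a) ((κ a).apply_ne_top b),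
    Finset.sum_mul]
  simp_rw [ENNReal.toReal_mul]

theorem expectation_pure (a : α) (g : α → ℝ) : expectation (PMF.pure a) g = g a := by
  classical
  unfold expectation
  rw [Finset.sum_eq_single a] <;> simp +contextual [PMF.pure_apply]

theorem expectation_map (μ : PMF α) (f : α → β) (g : β → ℝ) :
    expectation (μ.map f) g = expectation μ fun a => g (f a) := by
  rw [PMF.map, expectation_bind]
  simp_rw [Function.comp_apply, expectation_pure]

theorem expectation_uniformOfFintype [Nonempty α] (g : α → ℝ) :
    expectation (PMF.uniformOfFintype α) g = (Fintype.card α : ℝ)⁻¹ * ∑ a, g a := by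
  simp [expectation, Finset.mul_sum]

theorem expectation_mono {μ : PMF α} {g h : α → ℝ} (H : ∀ a ∈ μ.support, g a ≤ h a) :
    expectation μ g ≤ expectation μ h := by
  refine Finset.sum_le_sum fun a _ => ?_
  by_cases ha : a ∈ μ.support
  · exact mul_le_mul_of_nonneg_left (H a ha) ENNReal.toReal_nonneg
  · rw [PMF.mem_support_iff, not_not] at ha
    simp [ha]

theorem expectation_add (μ : PMF α) (g h : α → ℝ) :
    (expectation μ fun a => g a + h a) = expectation μ g + expectation μ h := by
  simp [expectation, mul_add, Finset.sum_add_distrib]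

theorem expectation_sum {ι : Type*} (s : Finset ι) (μ : PMF α) (g : ι → α → ℝ) :
    (expectation μ fun a => ∑ i ∈ s, g i a) = ∑ i ∈ s, expectation μ (g i) := by
  simp only [expectation, Finset.mul_sum]
  exact Finset.sum_comm

theorem expectation_const_mul (μ : PMF α) (c : ℝ) (g : α → ℝ) :
    (expectation μ fun a => c * g a) = c * expectation μ g := by
  simp only [expectation, Finset.mul_sum]
  exact Finset.sum_congr rfl fun a _ => by ring

theorem expectation_const (μ : PMF α) (c : ℝ) : (expectation μ fun _ => c) = c := by
  have h := μ.tsum_coe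
  rw [tsum_fintype] at h
  rw [expectation, ← Finset.sum_mul, ← ENNReal.toReal_sum fun a _ => μ.apply_ne_top a, h]
  simp

variable {ι : Type*} [Fintype ι] [DecidableEq ι]

theorem expectation_indep_prod (μ : ι → PMF α) (h : ι → α → ℝ) :
    (expectation (indep μ) fun o => ∏ i, h i (o i)) = ∏ i, expectation (μ i) (h i) := by
  simp only [expectation, indep, PMF.ofFintype_apply, ENNReal.toReal_prod,
      ← Finset.prod_mul_distrib]
  rw [Finset.prod_univ_sum, Fintype.piFinset_univ]

theorem expectation_indep_apply (μ : ι → PMF α) (i : ι) (g : α → ℝ) :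
    (expectation (indep μ) fun o => g (o i)) = expectation (μ i) g := by
  have h := expectation_indep_prod μ fun j => if j = i then g else fun _ => 1
  rw [Finset.prod_eq_single i (fun j _ hj => by simp [hj, expectation_const]) (by simp)] at h
  rw [if_pos rfl] at h
  rw [← h]
  congr 1
  funext o
  rw [Finset.prod_eq_single i (fun j _ hj => by simp [hj]) (by simp), if_pos rfl]

theorem expectation_indep_apply_mul (μ : ι → PMF α) {i j : ι} (hij : i ≠ j) (g h : α → ℝ) :
    (expectation (indep μ) fun o => g (o i) * h (o j)) =
        expectation (μ i) g * expectation (μ j) h := by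
  have H := expectation_indep_prod μ fun k => if k = i then g else if k = j then h else fun _ => 1
  rw [Finset.prod_eq_mul i j hij
    (fun k _ hk => by simp [hk.1, hk.2, expectation_const]) (by simp) (by simp)] at H
  rw [if_pos rfl, if_neg hij.symm, if_pos rfl] at H
  rw [← H]
  congr 1
  funext o
  rw [Finset.prod_eq_mul i j hij (fun k _ hk => by simp [hk.1, hk.2]) (by simp) (by simp),
      if_pos rfl, if_neg hij.symm, if_pos rfl]

theorem mem_support_of_mem_support_indep {μ : ι → PMF α} {o : ι → α} (h : o ∈ (indep μ).support)
    (i : ι) : o i ∈ (μ i).support := by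
  rw [PMF.mem_support_iff] at h ⊢
  exact fun h0 => h (Finset.prod_eq_zero (Finset.mem_univ i) h0)

end Expectation

/-! ### Random subsets -/

section RandomSubset
variable {V : Type*} [Fintype V] [DecidableEq V]

/-- The indicator of `u ∉ C`. -/
def out (u : V) (C : Finset V) : ℝ := if u ∈ C then 0 else 1

theorem expectation_coin (q : I) (g : Bool → ℝ) :
    expectation (coin q) g = q * g true + (1 - q) * g false := by
  have h0 := q.2.1
  have h1 := q.2.2
  simp [expectation, coin, PMF.ofFintype_apply, ENNReal.toReal_ofReal, h0, h1]

theorem subset_of_mem_support_randomSubset {S D : Finset V} {q : V → I}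
    (h : D ∈ (randomSubset S q).support) : D ⊆ S := by
  obtain ⟨b, -, rfl⟩ := (PMF.mem_support_map_iff _ _ _).1 h
  exact Finset.filter_subset _ _

theorem expectation_out {S : Finset V} (q : V → I) {u : V} (hu : u ∈ S) :
    (expectation (randomSubset S q) fun D => out u D) = 1 - q u := by
  rw [randomSubset, expectation_map]
  have := expectation_indep_apply (fun u => coin (q u)) u fun b => if b = true then 0 else 1
  simp only [expectation_coin] at this
  simpa [out, hu] using this

theorem expectation_out_mul_out {S : Finset V} (q : V → I) {u v : V} (hu : u ∈ S) (hv : v ∈ S)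
    (huv : u ≠ v) :
    (expectation (randomSubset S q) fun D => out u D * out v D) = (1 - q u) * (1 - q v) := by
  rw [randomSubset, expectation_map]
  have := expectation_indep_apply_mul (fun u => coin (q u)) huv (fun b => if b = true then 0 else 1)
      (fun b => if b = true then 0 else 1)
  simp only [expectation_coin] at this
  simpa [out, hu, hv] using this

end RandomSubset

/-! ### One run of the pivot algorithm -/

section Pivot
variable {V : Type*} [DecidableEq V] (f : EdgeSign → I → I) (sgn : Sym2 V → EdgeSign)
    (x : Sym2 V → I)

/-- The clusters `𝒞` partition `S` into nonempty sets. -/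
structure IsClusteringOf (S : Finset V) (𝒞 : Finset (Finset V)) : Prop where
  nonempty : ∀ C ∈ 𝒞, C.Nonempty
  subset : ∀ C ∈ 𝒞, C ⊆ S
  existsUnique : ∀ u ∈ S, ∃! C, C ∈ 𝒞 ∧ u ∈ C

theorem IsClusteringOf.insert_cluster {S C : Finset V} {𝒞 : Finset (Finset V)}
    (h : IsClusteringOf (S \ C) 𝒞) (hC : C.Nonempty) (hCS : C ⊆ S) :
    IsClusteringOf S (insert C 𝒞) where
  nonempty D hD := by
    rcases Finset.mem_insert.1 hD with rfl | hD
    exacts [hC, h.nonempty D hD]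
  subset D hD := by
    rcases Finset.mem_insert.1 hD with rfl | hD
    exacts [hCS, (h.subset D hD).trans Finset.sdiff_subset]
  existsUnique u hu := by
    by_cases huC : u ∈ C
    · refine ⟨C, ⟨Finset.mem_insert_self _ _, huC⟩, ?_⟩
      rintro D ⟨hD, huD⟩
      rcases Finset.mem_insert.1 hD with rfl | hD
      · rfl
      · exact absurd huC (Finset.mem_sdiff.1 (h.subset D hD huD)).2
    · obtain ⟨D, ⟨hD, huD⟩, hD'⟩ := h.existsUnique u (Finset.mem_sdiff.2 ⟨hu, huC⟩)
      refine ⟨D, ⟨Finset.mem_insert_of_mem hD, huD⟩, ?_⟩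
      rintro E ⟨hE, huE⟩
      rcases Finset.mem_insert.1 hE with rfl | hE
      · exact absurd huE huC
      · exact hD' E ⟨hE, huE⟩

open Classical in
/-- The cost of a pair `u, v` of sign `s` in the clustering `𝒞`, inside one colour class. A neutral
edge disagrees in every case, as the class does not have its colour. -/
def pairCost (s : EdgeSign) (𝒞 : Finset (Finset V)) (u v : V) : ℝ :=
  match s with
  | .plus => if ∃ C ∈ 𝒞, u ∈ C ∧ v ∈ C then 0 else 1
  | .minus => if ∃ C ∈ 𝒞, u ∈ C ∧ v ∈ C then 1 else 0
  | .neutral => 1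

theorem pairCost_nonneg (s : EdgeSign) (𝒟 : Finset (Finset V)) (u v : V) :
    0 ≤ pairCost s 𝒟 u v := by
  cases s <;> simp only [pairCost] <;> (try split_ifs) <;> norm_num

/-- The cost of `𝒞` inside `S`, summed over ordered pairs, so that every edge counts twice. -/
def clusterCost (S : Finset V) (𝒞 : Finset (Finset V)) : ℝ :=
  ∑ e ∈ S.offDiag, pairCost (sgn s(e.1, e.2)) 𝒞 e.1 e.2

theorem out_mul_out_ite (C : Finset V) (u v : V) (a : ℝ) :
    out u C * out v C * a = if u ∉ C ∧ v ∉ C then a else 0 := by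
  by_cases hu : u ∈ C <;> by_cases hv : v ∈ C <;> simp [out, hu, hv]

theorem pairCost_insert {S C : Finset V} {𝒞 : Finset (Finset V)} (h : ∀ D ∈ 𝒞, D ⊆ S \ C)
    (s : EdgeSign) (u v : V) :
    pairCost s (insert C 𝒞) u v =
      decisionCost s (out u C) (out v C) + out u C * out v C * pairCost s 𝒞 u v := by
  classical
  have hu : u ∈ C → ¬ ∃ D ∈ 𝒞, u ∈ D ∧ v ∈ D := fun hu ⟨D, hD, hD'⟩ =>
      (Finset.mem_sdiff.1 (h D hD hD'.1)).2 hu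
  have hv : v ∈ C → ¬ ∃ D ∈ 𝒞, u ∈ D ∧ v ∈ D := fun hv ⟨D, hD, hD'⟩ =>
      (Finset.mem_sdiff.1 (h D hD hD'.2)).2 hv
  by_cases hu' : u ∈ C <;> by_cases hv' : v ∈ C <;> cases s <;>
    simp only [pairCost, decisionCost, out, Finset.exists_mem_insert, hu', hv', hu, hv] <;> norm_num

theorem sum_offDiag_sdiff (S C : Finset V) (g : V → V → ℝ) :
    ∑ e ∈ (S \ C).offDiag, g e.1 e.2 = ∑ e ∈ S.offDiag, out e.1 C * out e.2 C * g e.1 e.2 := by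
  simp_rw [out_mul_out_ite]
  rw [← Finset.sum_filter]
  refine Finset.sum_congr ?_ fun _ _ => rfl
  ext ⟨u, v⟩
  simp only [Finset.mem_offDiag, Finset.mem_sdiff, Finset.mem_filter]
  tauto

theorem clusterCost_insert {S C : Finset V} {𝒞 : Finset (Finset V)} (h : ∀ D ∈ 𝒞, D ⊆ S \ C) :
    clusterCost sgn S (insert C 𝒞) =
      ∑ e ∈ S.offDiag, decisionCost (sgn s(e.1, e.2)) (out e.1 C) (out e.2 C) +
        clusterCost sgn (S \ C) 𝒞 := by
  unfold clusterCost
  rw [sum_offDiag_sdiff S C fun u v => pairCost (sgn s(u, v)) 𝒞 u v, ← Finset.sum_add_distrib]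
  exact Finset.sum_congr rfl fun e _ => pairCost_insert h _ _ _

/-- The probability that `u` stays out of the cluster of the pivot `w`; it is `0` for `u = w`. -/
def outProb (w u : V) : ℝ := if u = w then 0 else f (sgn s(u, w)) (x s(u, w))

/-- The excess of `2.15` times the expected LP value over the expected cost of the edge `uv`, when
it is decided in the step with pivot `w`. The LP values are `ℓ`. -/
def pivotSlack (ℓ : Sym2 V → ℝ) (w u v : V) : ℝ :=
  2.15 * ℓ s(u, v) * (1 - outProb f sgn x w u * outProb f sgn x w v) -
    decisionCost (sgn s(u, v)) (outProb f sgn x w u) (outProb f sgn x w v)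

/-- `decisionCost` is bi-affine, so its expectation depends only on the first moments and the mixed
moment of the indicators. -/
theorem decisionCost_affine (s : EdgeSign) :
    ∃ a b c : ℝ, ∀ p q, decisionCost s p q = a + b * p + b * q + c * (p * q) := by
  cases s
  · exact ⟨0, 1, -2, fun p q => by simp only [decisionCost]; ring⟩
  · exact ⟨1, -1, 1, fun p q => by simp only [decisionCost]; ring⟩
  · exact ⟨1, 0, -1, fun p q => by simp only [decisionCost]; ring⟩

theorem pivotSlack_comm (ℓ : Sym2 V → ℝ) (w u v : V) :
    pivotSlack f sgn x ℓ w u v = pivotSlack f sgn x ℓ w v u := by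
  rw [pivotSlack, pivotSlack, Sym2.eq_swap, mul_comm (outProb f sgn x w u), decisionCost_comm]

/-- The sum over all pivots and ordered pairs is a third of the sum over all triples of their
cyclic sums. A triple with a repeated vertex contributes the cases in which the pivot is an end
point. -/
theorem sum_pivotSlack_nonneg {ℓ : Sym2 V → ℝ} {S : Finset V}
    (h₂ : ∀ u ∈ S, ∀ v ∈ S, u ≠ v → 0 ≤ pivotSlack f sgn x ℓ u u v)
    (h₃ : ∀ u ∈ S, ∀ v ∈ S, ∀ w ∈ S, u ≠ v → v ≠ w → w ≠ u →
      0 ≤ pivotSlack f sgn x ℓ w u v + pivotSlack f sgn x ℓ u v w + pivotSlack f sgn x ℓ v w u) :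
    0 ≤ ∑ w ∈ S, ∑ e ∈ S.offDiag, pivotSlack f sgn x ℓ w e.1 e.2 := by
  set T : V → V → V → ℝ := fun w u v => if u = v then 0 else pivotSlack f sgn x ℓ w u v with hT
  have hT' : ∀ w, ∑ e ∈ S.offDiag, pivotSlack f sgn x ℓ w e.1 e.2 = ∑ u ∈ S, ∑ v ∈ S, T w u v := by
    intro w
    rw [← Finset.sum_product',
      show S.offDiag = (S ×ˢ S).filter fun e => e.1 ≠ e.2 by ext; simp [and_assoc],
      Finset.sum_filter]
    refine Finset.sum_congr rfl fun e _ => ?_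
    by_cases h : e.1 = e.2 <;> simp [hT, h]
  simp_rw [hT']
  have c1 : ∑ w ∈ S, ∑ u ∈ S, ∑ v ∈ S, T w u v = ∑ w ∈ S, ∑ u ∈ S, ∑ v ∈ S, T u v w := by
    rw [Finset.sum_comm_cycle]
  have c2 : ∑ w ∈ S, ∑ u ∈ S, ∑ v ∈ S, T w u v = ∑ w ∈ S, ∑ u ∈ S, ∑ v ∈ S, T v w u := by
    rw [Finset.sum_comm_cycle, Finset.sum_comm_cycle]
  have key : 0 ≤ ∑ w ∈ S, ∑ u ∈ S, ∑ v ∈ S, (T w u v + T u v w + T v w u) := by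
    refine Finset.sum_nonneg fun w hw => Finset.sum_nonneg fun u hu =>
      Finset.sum_nonneg fun v hv => ?_
    have hz : ∀ a b, T a b b = 0 := fun a b => if_pos rfl
    have hl : ∀ a ∈ S, ∀ b ∈ S, 0 ≤ T a a b := fun a ha b hb => by
      by_cases hab : a = b
      · simp [hT, hab]
      · simpa [hT, hab] using h₂ a ha b hb hab
    have hr : ∀ a ∈ S, ∀ b ∈ S, 0 ≤ T a b a := fun a ha b hb => by
      by_cases hab : a = b
      · simp [hT, hab]
      · simpa [hT, Ne.symm hab, pivotSlack_comm f sgn x ℓ a b a] using h₂ a ha b hb hab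
    by_cases huv : u = v
    · subst huv
      linarith [hz w u, hl u hu w hw, hr u hu w hw]
    by_cases hvw : v = w
    · subst hvw
      linarith [hz u v, hl v hv u hu, hr v hv u hu]
    by_cases hwu : w = u
    · subst hwu
      linarith [hz v w, hl w hw v hv, hr w hw v hv]
    · simpa [hT, huv, hvw, hwu] using h₃ u hu v hv w hw huv hvw hwu
  simp only [Finset.sum_add_distrib] at key
  linarith

variable [Fintype V]

theorem isClusteringOf_of_mem_support_lpPivot (S : Finset V) :
    ∀ 𝒞 ∈ (lpPivot f sgn x S).support, IsClusteringOf S 𝒞 := by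
  induction S using Finset.strongInduction with
  | H S ih =>
    intro 𝒞 h𝒞
    rw [lpPivot] at h𝒞
    split_ifs at h𝒞 with hS
    · simp only [PMF.mem_support_bind_iff, PMF.mem_support_map_iff] at h𝒞
      obtain ⟨w, -, D, hD, 𝒞', h𝒞', rfl⟩ := h𝒞
      have hDS := (subset_of_mem_support_randomSubset hD).trans (Finset.erase_subset _ _)
      have hCS : insert w.1 D ⊆ S := Finset.insert_subset w.2 hDS
      have hss : S \ insert w.1 D ⊂ S :=
        Finset.sdiff_ssubset hCS (Finset.insert_nonempty _ _)
      exact (ih _ hss 𝒞' h𝒞').insert_cluster (Finset.insert_nonempty _ _) hCS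
    · rw [PMF.support_pure, Set.mem_singleton_iff] at h𝒞
      rw [Finset.not_nonempty_iff_eq_empty] at hS
      subst h𝒞 hS
      exact ⟨by simp, by simp, by simp⟩

theorem expectation_out_insert {S : Finset V} {w u : V} (hu : u ∈ S) :
    (expectation (randomSubset (S.erase w) fun u => σ (f (sgn s(u, w)) (x s(u, w)))) fun D =>
      out u (insert w D)) = outProb f sgn x w u := by
  by_cases h : u = w
  · subst h
    simp [out, outProb, expectation_const]
  · have := expectation_out (S := S.erase w) (fun u => σ (f (sgn s(u, w)) (x s(u, w))))
        (Finset.mem_erase.2 ⟨h, hu⟩)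
    simpa [out, outProb, h] using this

theorem expectation_out_mul_out_insert {S : Finset V} {w u v : V} (hu : u ∈ S) (hv : v ∈ S)
    (huv : u ≠ v) :
    (expectation (randomSubset (S.erase w) fun u => σ (f (sgn s(u, w)) (x s(u, w)))) fun D =>
      out u (insert w D) * out v (insert w D)) =
    outProb f sgn x w u * outProb f sgn x w v := by
  by_cases h : u = w
  · subst h
    simp [out, outProb, expectation_const]
  by_cases h' : v = w
  · subst h'
    simp [out, outProb, expectation_const]
  · have := expectation_out_mul_out (S := S.erase w) (fun u => σ (f (sgn s(u, w)) (x s(u, w))))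
        (Finset.mem_erase.2 ⟨h, hu⟩) (Finset.mem_erase.2 ⟨h', hv⟩) huv
    simpa [out, outProb, h, h'] using this

theorem expectation_pivot_pair (ℓ : Sym2 V → ℝ) {S : Finset V} {w u v : V} (hu : u ∈ S) (hv : v ∈ S)
    (huv : u ≠ v) :
    (expectation (randomSubset (S.erase w) fun u => σ (f (sgn s(u, w)) (x s(u, w)))) fun D =>
      decisionCost (sgn s(u, v)) (out u (insert w D)) (out v (insert w D)) +
        2.15 * (out u (insert w D) * out v (insert w D) * ℓ s(u, v))) =
    2.15 * ℓ s(u, v) - pivotSlack f sgn x ℓ w u v := by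
  obtain ⟨a, b, c, h⟩ := decisionCost_affine (sgn s(u, v))
  have e : ∀ p q : ℝ, decisionCost (sgn s(u, v)) p q + 2.15 * (p * q * ℓ s(u, v)) =
      a + b * p + b * q + (c + 2.15 * ℓ s(u, v)) * (p * q) := fun p q => by rw [h]; ring
  simp only [e, expectation_add, expectation_const, expectation_const_mul]
  rw [expectation_out_insert f sgn x hu, expectation_out_insert f sgn x hv,
      expectation_out_mul_out_insert f sgn x hu hv huv, pivotSlack, h]
  ring

/-- Induction on the set of remaining vertices: in each step the expected cost of the decided edges
is at most `2.15` times their expected LP value, and the induction hypothesis pays for the rest. -/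
theorem expectation_lpPivot_le {ℓ : Sym2 V → ℝ} (S : Finset V)
    (h₂ : ∀ u ∈ S, ∀ v ∈ S, u ≠ v → 0 ≤ pivotSlack f sgn x ℓ u u v)
    (h₃ : ∀ u ∈ S, ∀ v ∈ S, ∀ w ∈ S, u ≠ v → v ≠ w → w ≠ u →
      0 ≤ pivotSlack f sgn x ℓ w u v + pivotSlack f sgn x ℓ u v w + pivotSlack f sgn x ℓ v w u) :
    expectation (lpPivot f sgn x S) (clusterCost sgn S) ≤
      2.15 * ∑ e ∈ S.offDiag, ℓ s(e.1, e.2) := by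
  induction S using Finset.strongInduction with
  | H S ih =>
    rw [lpPivot]
    split_ifs with hS
    · have : Nonempty {v // v ∈ S} := hS.to_subtype
      have hpos : (0 : ℝ) < Fintype.card {v // v ∈ S} := by exact_mod_cast Fintype.card_pos
      simp only [expectation_bind, expectation_map]
      rw [expectation_uniformOfFintype, inv_mul_le_iff₀ hpos]
      have step : ∀ w : {v // v ∈ S}, expectation
          (randomSubset (S.erase w) fun u => σ (f (sgn s(u, w.1)) (x s(u, w.1))))
          (fun D => expectation (lpPivot f sgn x (S \ insert w.1 D)) fun 𝒞 =>
            clusterCost sgn S (insert (insert w.1 D) 𝒞)) ≤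
          2.15 * ∑ e ∈ S.offDiag, ℓ s(e.1, e.2) -
            ∑ e ∈ S.offDiag, pivotSlack f sgn x ℓ w e.1 e.2 := by
        intro w
        calc _ ≤ expectation (randomSubset (S.erase w) fun u =>
              σ (f (sgn s(u, w.1)) (x s(u, w.1)))) fun D =>
              ∑ e ∈ S.offDiag, (decisionCost (sgn s(e.1, e.2)) (out e.1 (insert w.1 D))
                  (out e.2 (insert w.1 D)) +
                2.15 * (out e.1 (insert w.1 D) * out e.2 (insert w.1 D) * ℓ s(e.1, e.2))) := by
              refine expectation_mono fun D hD => ?_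
              have hDS := (subset_of_mem_support_randomSubset hD).trans (Finset.erase_subset _ _)
              have hss : S \ insert w.1 D ⊂ S :=
                Finset.sdiff_ssubset (Finset.insert_subset w.2 hDS) (Finset.insert_nonempty _ _)
              have hsub := hss.subset
              have IH := ih _ hss (fun u hu v hv => h₂ u (hsub hu) v (hsub hv))
                (fun u hu v hv w hw => h₃ u (hsub hu) v (hsub hv) w (hsub hw))
              rw [sum_offDiag_sdiff S (insert w.1 D) fun u v => ℓ s(u, v)] at IH
              rw [Finset.sum_add_distrib, ← Finset.mul_sum]
              refine le_trans ?_ (add_le_add_right IH _)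
              rw [← expectation_const (lpPivot f sgn x (S \ insert w.1 D)) (∑ e ∈ S.offDiag, _),
                  ← expectation_add]
              refine expectation_mono fun 𝒞 h𝒞 => ?_
              rw [clusterCost_insert sgn
                (isClusteringOf_of_mem_support_lpPivot f sgn x _ 𝒞 h𝒞).subset]
          _ = _ := by
              rw [expectation_sum, Finset.mul_sum, ← Finset.sum_sub_distrib]
              refine Finset.sum_congr rfl fun e he => ?_
              obtain ⟨hu, hv, huv⟩ := Finset.mem_offDiag.1 he
              exact expectation_pivot_pair f sgn x ℓ hu hv huv
      refine (Finset.sum_le_sum fun w _ => step w).trans ?_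
      rw [Finset.sum_sub_distrib, Finset.sum_const, Finset.card_univ, nsmul_eq_mul,
        Finset.sum_coe_sort S fun w => ∑ e ∈ S.offDiag, pivotSlack f sgn x ℓ w e.1 e.2]
      linarith [sum_pivotSlack_nonneg f sgn x h₂ h₃]
    · rw [Finset.not_nonempty_iff_eq_empty] at hS
      subst hS
      simp [expectation_pure, clusterCost]

end Pivot

/-! ### LP values inside a colour class -/

section LP
variable {V L : Type*} [Fintype L]

/-- The LP value of the edge `e`, as seen from the class of colour `c`: one summand of the
objective. -/
def edgeLP (φ : Sym2 V → Option L) (x : LPPoint V L) (c : L) (e : Sym2 V) : ℝ :=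
  match φ e with
  | none => 1 - (x.edge c e : ℝ)
  | some d => (x.edge d e : ℝ)

variable {φ : Sym2 V → Option L} {x : LPPoint V L}

/-- The numbers `1 - x_u^c` are nonnegative with sum one, so two of them sum to at most one. -/
theorem LPPoint.IsFeasible.one_le_vert_add_vert (hx : x.IsFeasible) (u : V) {c d : L}
    (hcd : c ≠ d) : 1 ≤ (x.vert u c : ℝ) + x.vert u d := by
  classical
  have h : ∑ c : L, (1 - (x.vert u c : ℝ)) = 1 := by
    rw [Finset.sum_sub_distrib, hx.sum_vert u]
    simp
  have h2 : ∑ c ∈ {c, d}, (1 - (x.vert u c : ℝ)) ≤ ∑ c : L, (1 - (x.vert u c : ℝ)) :=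
    Finset.sum_le_sum_of_subset_of_nonneg (Finset.subset_univ _) fun c _ _ =>
      sub_nonneg.2 (x.vert u c).2.2
  rw [Finset.sum_pair hcd] at h2
  linarith

theorem mem_colorClass {V L : Type*} [Fintype V] {x : LPPoint V L} {c : L} {u : V} :
    u ∈ colorClass x c ↔ (x.vert u c : ℝ) < 1 / 2 := by
  simp [colorClass]

theorem LPPoint.IsFeasible.eq_of_mem_colorClass [Fintype V] (hx : x.IsFeasible) {u : V} {c d : L}
    (hc : u ∈ colorClass x c) (hd : u ∈ colorClass x d) : c = d := by
  by_contra h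
  have := hx.one_le_vert_add_vert u h
  rw [mem_colorClass] at hc hd
  linarith

theorem LPPoint.IsFeasible.triangle' (hx : x.IsFeasible) (c : L) {u v w : V} (huv : u ≠ v)
    (hvw : v ≠ w) (hwu : w ≠ u) :
    (x.edge c s(u, v) : ℝ) ≤ x.edge c s(v, w) + x.edge c s(w, u) := hx.triangle c v w u hvw hwu huv

/-- An edge of another colour `d` has `x_{uv}^d ≥ x_u^d ≥ 1 - x_u^c`, and `x_u^c` is at most the
value of each edge at `u`; the same with `v` in place of `u` covers the third edge. -/
theorem LPPoint.IsFeasible.isEdgeLP [Fintype V] (hx : x.IsFeasible) {c : L} {u v w : V}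
    (hu : u ∈ colorClass x c) (huv : u ≠ v) (hvw : v ≠ w) (hwu : w ≠ u) :
    IsEdgeLP (signOf φ c s(u, v)) (edgeLP φ x c s(u, v)) (x.edge c s(u, v)) (x.edge c s(v, w))
        (x.edge c s(w, u)) := by
  rcases h : φ s(u, v) with _ | d
  · simp only [signOf, edgeLP, h, IsEdgeLP]
  · by_cases hdc : d = c
    · simp only [signOf, edgeLP, h, IsEdgeLP, hdc, if_true]
    · simp only [signOf, edgeLP, h, IsEdgeLP, hdc, if_false]
      rw [mem_colorClass] at hu
      have h1 := hx.one_le_vert_add_vert u hdc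
      have h2 := hx.one_le_vert_add_vert v hdc
      have h3 : (x.vert u d : ℝ) ≤ x.edge d s(u, v) := hx.vert_le_edge d u v huv
      have h4 : (x.vert v d : ℝ) ≤ x.edge d s(u, v) := by
        rw [Sym2.eq_swap]
        exact hx.vert_le_edge d v u huv.symm
      have h5 : (x.vert u c : ℝ) ≤ x.edge c s(u, v) := hx.vert_le_edge c u v huv
      have h6 : (x.vert v c : ℝ) ≤ x.edge c s(v, w) := hx.vert_le_edge c v w hvw
      have h7 : (x.vert u c : ℝ) ≤ x.edge c s(w, u) := by
        rw [Sym2.eq_swap]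
        exact hx.vert_le_edge c u w hwu.symm
      refine ⟨?_, ?_, ?_, ?_⟩ <;> linarith

theorem LPPoint.IsFeasible.half_le_edgeLP_of_neutral [Fintype V] (hx : x.IsFeasible) {c d : L}
    {u v : V} (hu : u ∈ colorClass x c) (huv : u ≠ v) (hdc : d ≠ c) :
    1 / 2 ≤ (x.edge d s(u, v) : ℝ) := by
  have h1 := hx.one_le_vert_add_vert u hdc
  have h3 : (x.vert u d : ℝ) ≤ x.edge d s(u, v) := hx.vert_le_edge d u v huv
  rw [mem_colorClass] at hu
  linarith

open Classical in
/-- The edge `uv` lies in at most one colour class, and a coloured edge that lies in none has LP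
value at least one half. -/
theorem LPPoint.IsFeasible.sum_edgeLP_le [Fintype V] [DecidableEq V] (φ : Sym2 V → Option L)
    (hx : x.IsFeasible) {u v : V} (huv : u ≠ v) :
    2.15 * ∑ c, (if u ∈ colorClass x c ∧ v ∈ colorClass x c then edgeLP φ x c s(u, v) else 0) +
      (if φ s(u, v) ≠ none ∧ ¬ ∃ c, u ∈ colorClass x c ∧ v ∈ colorClass x c then 1 else 0) ≤
    2.15 * (match φ s(u, v) with
      | some c => (x.edge c s(u, v) : ℝ)
      | none => ∑ c : L, (1 - (x.edge c s(u, v) : ℝ))) := by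
  rcases hφ : φ s(u, v) with _ | d
  · simp only [ne_eq, not_true_eq_false, false_and, if_false, add_zero]
    refine mul_le_mul_of_nonneg_left (Finset.sum_le_sum fun c _ => ?_) (by norm_num)
    have := (x.edge c s(u, v)).2.2
    split_ifs
    · simp only [edgeLP, hφ, le_refl]
    · linarith
  · have h0 := (x.edge d s(u, v)).2.1
    by_cases hc : ∃ c, u ∈ colorClass x c ∧ v ∈ colorClass x c
    · obtain ⟨c, hc⟩ := hc
      rw [if_neg (by simpa using ⟨c, hc⟩), Finset.sum_eq_single c, if_pos hc]
      · simp only [edgeLP, hφ, add_zero, le_refl]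
      · intro b _ hb
        exact if_neg fun h => hb (hx.eq_of_mem_colorClass h.1 hc.1)
      · simp
    · rw [if_pos (⟨by simp, hc⟩ : some d ≠ none ∧ _),
          Finset.sum_eq_zero fun c _ => if_neg fun h => hc ⟨c, h⟩]
      have h1 : (x.vert u d : ℝ) ≤ x.edge d s(u, v) := hx.vert_le_edge d u v huv
      have h2 : (x.vert v d : ℝ) ≤ x.edge d s(u, v) := by
        rw [Sym2.eq_swap]
        exact hx.vert_le_edge d v u huv.symm
      have h3 : 1 / 2 ≤ (x.edge d s(u, v) : ℝ) := by
        by_contra h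
        exact hc ⟨d, mem_colorClass.2 (by linarith), mem_colorClass.2 (by linarith)⟩
      simp only
      linarith

variable [DecidableEq V]

theorem outProb_self (f : EdgeSign → I → I) (sgn : Sym2 V → EdgeSign) (y : Sym2 V → I) (u : V) :
    outProb f sgn y u u = 0 := if_pos rfl

theorem outProb_of_ne (f : EdgeSign → I → I) (sgn : Sym2 V → EdgeSign) (y : Sym2 V → I) {w u : V}
    (h : u ≠ w) :
    outProb f sgn y w u = f (sgn s(u, w)) (y s(u, w)) := if_neg h

theorem outProb_of_ne' (f : EdgeSign → I → I) (sgn : Sym2 V → EdgeSign) (y : Sym2 V → I) {w u : V}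
    (h : u ≠ w) :
    outProb f sgn y w u = f (sgn s(w, u)) (y s(w, u)) := by
  rw [Sym2.eq_swap]
  exact if_neg h

theorem LPPoint.IsFeasible.pivotSlack_pair_nonneg [Fintype V] (hx : x.IsFeasible) {c : L} {u v : V}
    (hu : u ∈ colorClass x c) (huv : u ≠ v) :
    0 ≤ pivotSlack rounding (signOf φ c) (x.edge c) (edgeLP φ x c) u u v := by
  rw [pivotSlack, outProb_self, outProb_of_ne' _ _ _ huv.symm]
  have h0 := (x.edge c s(u, v)).2.1
  have h1 := (x.edge c s(u, v)).2.2
  rcases h : φ s(u, v) with _ | d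
  · simp only [signOf, edgeLP, h, decisionCost, rounding, fMinus]
    linarith
  · by_cases hdc : d = c
    · simp only [signOf, edgeLP, h, decisionCost, rounding, hdc, if_true]
      linarith [(fPlus_bounds _ h0).2.1]
    · simp only [signOf, edgeLP, h, decisionCost, hdc, if_false]
      linarith [hx.half_le_edgeLP_of_neutral hu huv hdc]

theorem LPPoint.IsFeasible.pivotSlack_triple_nonneg [Fintype V] (hx : x.IsFeasible) {c : L}
    {u v w : V} (hu : u ∈ colorClass x c) (hv : v ∈ colorClass x c) (hw : w ∈ colorClass x c)
    (huv : u ≠ v) (hvw : v ≠ w) (hwu : w ≠ u) :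
    0 ≤ pivotSlack rounding (signOf φ c) (x.edge c) (edgeLP φ x c) w u v +
      pivotSlack rounding (signOf φ c) (x.edge c) (edgeLP φ x c) u v w +
      pivotSlack rounding (signOf φ c) (x.edge c) (edgeLP φ x c) v w u := by
  have h := tripleBound (signOf φ c s(u, v)) (signOf φ c s(v, w)) (signOf φ c s(w, u))
    (x.edge c s(u, v)) (x.edge c s(v, w)) (x.edge c s(w, u)) (edgeLP φ x c s(u, v))
    (edgeLP φ x c s(v, w)) (edgeLP φ x c s(w, u))
    (hx.triangle' c huv hvw hwu) (by linarith [hx.triangle' c hvw hwu huv])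
    (hx.triangle' c hwu huv hvw)
    (hx.isEdgeLP hu huv hvw hwu) (hx.isEdgeLP hv hvw hwu huv).swap (hx.isEdgeLP hw hwu huv hvw)
  simp only [pivotSlack]
  rw [outProb_of_ne' _ _ _ hwu.symm, outProb_of_ne _ _ _ hvw, outProb_of_ne' _ _ _ huv.symm,
      outProb_of_ne _ _ _ hwu, outProb_of_ne' _ _ _ hvw.symm, outProb_of_ne _ _ _ huv]
  rw [decisionCost_comm (signOf φ c s(u, v))] at h
  rw [decisionCost_comm (signOf φ c s(w, u))]
  linarith

theorem LPPoint.IsFeasible.expectation_clusterCost_le [Fintype V] (hx : x.IsFeasible) (c : L) :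
    expectation (lpPivot rounding (signOf φ c) (x.edge c) (colorClass x c))
        (clusterCost (signOf φ c) (colorClass x c)) ≤
      2.15 * ∑ e ∈ (colorClass x c).offDiag, edgeLP φ x c s(e.1, e.2) :=
  expectation_lpPivot_le _ _ _ _ (fun _ hu _ _ huv => hx.pivotSlack_pair_nonneg hu huv)
    fun _ hu _ hv _ hw huv hvw hwu => hx.pivotSlack_triple_nonneg hu hv hw huv hvw hwu

end LP

/-! ### Sums over edges and over ordered pairs -/

section EdgeSums
variable {V : Type*} [Fintype V] [DecidableEq V]

theorem two_mul_sum_edges (h : Sym2 V → ℝ) :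
    2 * ∑ e ∈ edges V, h e = ∑ p ∈ (Finset.univ : Finset V).offDiag, h s(p.1, p.2) := by
  have hmaps : ∀ p ∈ (Finset.univ : Finset V).offDiag, s(p.1, p.2) ∈ edges V := by
    intro p hp
    simpa [edges] using (Finset.mem_offDiag.1 hp).2.2
  rw [← Finset.sum_fiberwise_of_maps_to hmaps, Finset.mul_sum]
  refine Finset.sum_congr rfl fun e he => ?_
  induction e using Sym2.inductionOn with
  | hf u v =>
    have huv : u ≠ v := by simpa [edges] using he
    have : ((Finset.univ : Finset V).offDiag.filter fun p => s(p.1, p.2) = s(u, v)) =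
        {(u, v), (v, u)} := by
      ext ⟨y, z⟩
      simp only [Finset.mem_filter, Finset.mem_offDiag, Finset.mem_univ, true_and, Sym2.eq_iff,
        Finset.mem_insert, Finset.mem_singleton, Prod.mk.injEq]
      constructor
      · exact fun h => h.2
      · rintro (⟨rfl, rfl⟩ | ⟨rfl, rfl⟩)
        exacts [⟨huv, Or.inl ⟨rfl, rfl⟩⟩, ⟨huv.symm, Or.inr ⟨rfl, rfl⟩⟩]
    rw [this, Finset.sum_pair (by simp [huv]), Sym2.eq_swap (a := v)]
    ring

theorem sum_offDiag_eq_ite (S : Finset V) (g : V → V → ℝ) :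
    ∑ e ∈ S.offDiag, g e.1 e.2 =
      ∑ e ∈ (Finset.univ : Finset V).offDiag, if e.1 ∈ S ∧ e.2 ∈ S then g e.1 e.2 else 0 := by
  rw [← Finset.sum_filter]
  refine Finset.sum_congr ?_ fun _ _ => rfl
  ext ⟨u, v⟩
  simp only [Finset.mem_offDiag, Finset.mem_filter, Finset.mem_univ, true_and]
  tauto

open Classical in
theorem cost_eq_sum {L : Type*} (φ : Sym2 V → Option L) (K : Finset (Finset V × L)) :
    (cost φ K : ℝ) = ∑ e ∈ edges V, if Disagrees φ K e then (1 : ℝ) else 0 := by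
  rw [cost, Finset.card_filter]
  push_cast
  rfl

end EdgeSums

/-! ### The output of LP-CCC -/

section Assemble
variable {V L : Type*} [Fintype V] [DecidableEq V] [Fintype L] [DecidableEq L]

open Classical in
/-- The coloured clustering that `LP-CCC` builds from the clusterings `𝒞 c` of the colour
classes. -/
noncomputable def assemble (x : LPPoint V L) (a : V → L) (𝒞 : L → Finset (Finset V)) :
    Finset (Finset V × L) :=
  ((Finset.univ.filter fun u : V => ¬ ∃ c, (x.vert u c : ℝ) < 1 / 2).image fun u => ({u}, a u)) ∪
    Finset.univ.biUnion fun c : L => (𝒞 c).image fun C => (C, c)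

theorem lpCCC_eq (φ : Sym2 V → Option L) (x : LPPoint V L) (a : V → L) :
    lpCCC φ x a = (indep fun c : L => lpPivot rounding (signOf φ c) (x.edge c) (colorClass x c)).map
        (assemble x a) := rfl

theorem mem_assemble {x : LPPoint V L} {a : V → L} {𝒞 : L → Finset (Finset V)} {p : Finset V × L} :
    p ∈ assemble x a 𝒞 ↔ (∃ u, (∀ c, u ∉ colorClass x c) ∧ p = ({u}, a u)) ∨ p.1 ∈ 𝒞 p.2 := by
  obtain ⟨C, c⟩ := p
  simp only [assemble, Finset.mem_union, Finset.mem_image, Finset.mem_filter, Finset.mem_univ,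
    true_and, Finset.mem_biUnion, mem_colorClass, not_exists, Prod.mk.injEq]
  constructor
  · rintro (⟨u, h, h1, h2⟩ | ⟨d, D, hD, rfl, rfl⟩)
    · exact Or.inl ⟨u, h, h1.symm, h2.symm⟩
    · exact Or.inr hD
  · rintro (⟨u, h, h1, h2⟩ | h)
    · exact Or.inl ⟨u, h, h1.symm, h2.symm⟩
    · exact Or.inr ⟨c, C, h, rfl, rfl⟩

variable {φ : Sym2 V → Option L} {x : LPPoint V L} {a : V → L} {𝒞 : L → Finset (Finset V)}

theorem isChromaticClustering_assemble (hx : x.IsFeasible)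
    (h : ∀ c, IsClusteringOf (colorClass x c) (𝒞 c)) :
    IsChromaticClustering (assemble x a 𝒞) := by
  refine ⟨fun p hp => ?_, fun u => ?_⟩
  · rcases mem_assemble.1 hp with ⟨u, -, rfl⟩ | hp
    · exact Finset.singleton_nonempty u
    · exact (h p.2).nonempty _ hp
  · by_cases hu : ∃ c, u ∈ colorClass x c
    · obtain ⟨c, hc⟩ := hu
      obtain ⟨C, ⟨hC, huC⟩, hC'⟩ := (h c).existsUnique u hc
      refine ⟨(C, c), ⟨mem_assemble.2 (Or.inr hC), huC⟩, ?_⟩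
      rintro ⟨D, d⟩ ⟨hD, huD⟩
      rcases mem_assemble.1 hD with ⟨v, hv, hvD⟩ | hD
      · obtain ⟨rfl, rfl⟩ := Prod.mk.inj hvD
        obtain rfl := Finset.mem_singleton.1 huD
        exact absurd hc (hv c)
      · obtain rfl := hx.eq_of_mem_colorClass hc ((h d).subset D hD huD)
        rw [hC' D ⟨hD, huD⟩]
    · rw [not_exists] at hu
      refine ⟨({u}, a u), ⟨mem_assemble.2 (Or.inl ⟨u, hu, rfl⟩), Finset.mem_singleton_self u⟩, ?_⟩
      rintro ⟨D, d⟩ ⟨hD, huD⟩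
      rcases mem_assemble.1 hD with ⟨v, hv, hvD⟩ | hD
      · obtain ⟨rfl, rfl⟩ := Prod.mk.inj hvD
        obtain rfl := Finset.mem_singleton.1 huD
        rfl
      · exact absurd ((h d).subset D hD huD) (hu d)

open Classical in
/-- A disagreement inside a colour class is paid for by `pairCost`; any other is a coloured edge
that lies in no class. -/
theorem disagrees_assemble_le (h : ∀ c, IsClusteringOf (colorClass x c) (𝒞 c)) {u v : V}
    (huv : u ≠ v) :
    (if Disagrees φ (assemble x a 𝒞) s(u, v) then 1 else 0 : ℝ) ≤
      ∑ c, (if u ∈ colorClass x c ∧ v ∈ colorClass x c then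
        pairCost (signOf φ c s(u, v)) (𝒞 c) u v else 0) +
      (if φ s(u, v) ≠ none ∧ ¬ ∃ c, u ∈ colorClass x c ∧ v ∈ colorClass x c then 1 else 0) := by
  have hnn : ∀ c ∈ Finset.univ, 0 ≤
      (if u ∈ colorClass x c ∧ v ∈ colorClass x c then
        pairCost (signOf φ c s(u, v)) (𝒞 c) u v else 0) := by
    intro c _
    split_ifs
    exacts [pairCost_nonneg _ _ _ _, le_rfl]
  have hnn2 : (0 : ℝ) ≤
      (if φ s(u, v) ≠ none ∧ ¬ ∃ c, u ∈ colorClass x c ∧ v ∈ colorClass x c then 1 else 0) := by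
    split_ifs <;> norm_num
  have hs := fun c => Finset.single_le_sum hnn (Finset.mem_univ c)
  by_cases hd : Disagrees φ (assemble x a 𝒞) s(u, v)
  swap
  · rw [if_neg hd]
    exact add_nonneg (Finset.sum_nonneg hnn) hnn2
  rw [if_pos hd]
  rcases hφ : φ s(u, v) with _ | d
  · simp only [Disagrees, hφ] at hd
    obtain ⟨p, hp, hpe⟩ := hd
    have hup := hpe u (Sym2.mem_mk_left u v)
    have hvp := hpe v (Sym2.mem_mk_right u v)
    rcases mem_assemble.1 hp with ⟨w, -, rfl⟩ | hp
    · exact absurd ((Finset.mem_singleton.1 hup).trans (Finset.mem_singleton.1 hvp).symm) huv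
    · have := hs p.2
      rw [if_pos ⟨(h _).subset _ hp hup, (h _).subset _ hp hvp⟩] at this
      simp only [signOf, hφ, pairCost] at this
      rw [if_pos ⟨_, hp, hup, hvp⟩] at this
      simp only [signOf, hφ, pairCost] at hnn2 ⊢
      linarith
  · by_cases hc : ∃ c, u ∈ colorClass x c ∧ v ∈ colorClass x c
    · obtain ⟨c, hc⟩ := hc
      have := hs c
      rw [if_pos hc] at this
      have h1 : pairCost (signOf φ c s(u, v)) (𝒞 c) u v = 1 := by
        by_cases hdc : d = c
        · simp only [signOf, hφ, hdc, if_true, pairCost]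
          refine if_neg fun ⟨C, hC, hu, hv⟩ => ?_
          simp only [Disagrees, hφ] at hd
          refine hd ⟨(C, c), mem_assemble.2 (Or.inr hC), hdc.symm, fun y hy => ?_⟩
          rcases Sym2.mem_iff.1 hy with rfl | rfl
          exacts [hu, hv]
        · simp only [signOf, hφ, hdc, if_false, pairCost]
      rw [h1] at this
      rw [hφ] at hnn2
      linarith
    · rw [if_pos (⟨by simp, hc⟩ : some d ≠ none ∧ _)]
      linarith [Finset.sum_nonneg hnn]

open Classical in
theorem LPPoint.IsFeasible.expectation_cost_le (hx : x.IsFeasible) :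
    expectation (lpCCC φ x a) (fun K => (cost φ K : ℝ)) ≤ 2.15 * x.objective φ := by
  set R : ℝ := ∑ e ∈ (Finset.univ : Finset V).offDiag,
    (if φ s(e.1, e.2) ≠ none ∧ ¬ ∃ c, e.1 ∈ colorClass x c ∧ e.2 ∈ colorClass x c then 1 else 0)
    with hR
  have h1 : expectation (lpCCC φ x a) (fun K => 2 * (cost φ K : ℝ)) ≤
      ∑ c, expectation (lpPivot rounding (signOf φ c) (x.edge c) (colorClass x c))
          (clusterCost (signOf φ c) (colorClass x c)) + R := by
    rw [lpCCC_eq, expectation_map]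
    calc _ ≤ expectation (indep fun c : L =>
            lpPivot rounding (signOf φ c) (x.edge c) (colorClass x c))
          (fun 𝒞 => ∑ c, clusterCost (signOf φ c) (colorClass x c) (𝒞 c) + R) := by
          refine expectation_mono fun 𝒞 h𝒞 => ?_
          have h := fun c => isClusteringOf_of_mem_support_lpPivot _ _ _ _ _
              (mem_support_of_mem_support_indep h𝒞 c)
          rw [cost_eq_sum φ, two_mul_sum_edges]
          refine (Finset.sum_le_sum fun e he => disagrees_assemble_le h
              (Finset.mem_offDiag.1 he).2.2).trans_eq ?_
          rw [Finset.sum_add_distrib, Finset.sum_comm]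
          congr 1
          exact Finset.sum_congr rfl fun c _ =>
              (sum_offDiag_eq_ite _ fun u v => pairCost (signOf φ c s(u, v)) (𝒞 c) u v).symm
      _ = _ := by
          rw [expectation_add, expectation_sum, expectation_const]
          congr 1
          exact Finset.sum_congr rfl fun c _ => expectation_indep_apply _ c
              (clusterCost (signOf φ c) (colorClass x c))
  have h2 : 2.15 * ∑ c, ∑ e ∈ (colorClass x c).offDiag, edgeLP φ x c s(e.1, e.2) + R ≤
      2 * (2.15 * x.objective φ) := by
    have hL : ∑ c, ∑ e ∈ (colorClass x c).offDiag, edgeLP φ x c s(e.1, e.2) =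
        ∑ e ∈ (Finset.univ : Finset V).offDiag, ∑ c,
          (if e.1 ∈ colorClass x c ∧ e.2 ∈ colorClass x c then edgeLP φ x c s(e.1, e.2)
            else 0) := by
      rw [Finset.sum_comm]
      exact Finset.sum_congr rfl fun c _ => sum_offDiag_eq_ite _ fun u v => edgeLP φ x c s(u, v)
    rw [mul_left_comm, LPPoint.objective, two_mul_sum_edges, hL, hR, Finset.mul_sum, Finset.mul_sum,
      ← Finset.sum_add_distrib]
    exact Finset.sum_le_sum fun e he => hx.sum_edgeLP_le φ (Finset.mem_offDiag.1 he).2.2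
  have h3 := Finset.sum_le_sum fun c (_ : c ∈ (Finset.univ : Finset L)) =>
      hx.expectation_clusterCost_le (φ := φ) c
  rw [← Finset.mul_sum] at h3
  rw [expectation_const_mul] at h1
  linarith

end Assemble

/-! ### Clusterings as integral points of the linear program -/

section Integral
variable {V L : Type*} [Fintype V] [DecidableEq V] [Fintype L]

open Classical in
/-- The integral point of the linear program that corresponds to the clustering `K`. -/
noncomputable def integralPoint (K : Finset (Finset V × L)) : LPPoint V L where
  vert u c := if ∃ p ∈ K, p.2 = c ∧ u ∈ p.1 then 0 else 1
  edge c e := if ∃ p ∈ K, p.2 = c ∧ ∀ u ∈ e, u ∈ p.1 then 0 else 1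

variable {K : Finset (Finset V × L)}

theorem isFeasible_integralPoint (hK : IsChromaticClustering K) : (integralPoint K).IsFeasible where
  vert_le_edge c u v _ := by
    simp only [integralPoint]
    by_cases h : ∃ p ∈ K, p.2 = c ∧ ∀ y ∈ s(u, v), y ∈ p.1
    · obtain ⟨p, hp, hc, he⟩ := h
      rw [if_pos ⟨p, hp, hc, he u (Sym2.mem_mk_left u v)⟩]
      exact bot_le
    · rw [if_neg h]
      exact le_top
  triangle c u v w _ _ _ := by
    simp only [integralPoint]
    by_cases h1 : ∃ p ∈ K, p.2 = c ∧ ∀ y ∈ s(u, v), y ∈ p.1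
    · by_cases h2 : ∃ p ∈ K, p.2 = c ∧ ∀ y ∈ s(v, w), y ∈ p.1
      · obtain ⟨p, hp, hpc, hpe⟩ := h1
        obtain ⟨q, hq, hqc, hqe⟩ := h2
        obtain rfl := (hK.2 v).unique ⟨hp, hpe v (Sym2.mem_mk_right u v)⟩
            ⟨hq, hqe v (Sym2.mem_mk_left v w)⟩
        have : ∃ p ∈ K, p.2 = c ∧ ∀ y ∈ s(w, u), y ∈ p.1 := by
          refine ⟨p, hp, hpc, fun y hy => ?_⟩
          rcases Sym2.mem_iff.1 hy with rfl | rfl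
          exacts [hqe _ (Sym2.mem_mk_right _ _), hpe _ (Sym2.mem_mk_left _ _)]
        rw [if_pos this]
        split_ifs <;> norm_num
      · rw [if_neg h2]
        split_ifs <;> norm_num
    · rw [if_neg h1]
      split_ifs <;> norm_num
  sum_vert u := by
    classical
    obtain ⟨p, ⟨hp, hu⟩, hp'⟩ := hK.2 u
    have h : ∀ c, (((integralPoint K).vert u c : I) : ℝ) = 1 - if c = p.2 then 1 else 0 := by
      intro c
      simp only [integralPoint]
      by_cases hc : c = p.2
      · rw [if_pos ⟨p, hp, hc.symm, hu⟩, if_pos hc]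
        simp
      · rw [if_neg, if_neg hc]
        · simp
        · rintro ⟨q, hq, rfl, huq⟩
          exact hc (by rw [hp' q ⟨hq, huq⟩])
    simp_rw [h]
    simp

theorem objective_integralPoint (φ : Sym2 V → Option L) (hK : IsChromaticClustering K) :
    (integralPoint K).objective φ = cost φ K := by
  classical
  rw [cost_eq_sum, LPPoint.objective]
  refine Finset.sum_congr rfl fun e _ => ?_
  rcases hφ : φ e with _ | d
  · simp only [Disagrees, hφ, integralPoint]
    by_cases h : ∃ p ∈ K, ∀ u ∈ e, u ∈ p.1
    · obtain ⟨p, hp, hpe⟩ := h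
      rw [if_pos ⟨p, hp, hpe⟩, Finset.sum_eq_single p.2]
      · rw [if_pos ⟨p, hp, rfl, hpe⟩]
        simp
      · intro c _ hc
        rw [if_neg]
        · simp
        · rintro ⟨q, hq, rfl, hqe⟩
          induction e using Sym2.inductionOn with
          | hf u v =>
            exact hc (by rw [(hK.2 u).unique ⟨hq, hqe u (Sym2.mem_mk_left u v)⟩
                ⟨hp, hpe u (Sym2.mem_mk_left u v)⟩])
      · simp
    · rw [if_neg h]
      refine Finset.sum_eq_zero fun c _ => ?_
      rw [if_neg fun ⟨p, hp, _, hpe⟩ => h ⟨p, hp, hpe⟩]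
      simp
  · simp only [Disagrees, hφ, integralPoint]
    split_ifs with h <;> simp

end Integral

end CCC

theorem mainTheorem3 {V L : Type*} [Fintype V] [DecidableEq V] [Fintype L] [DecidableEq L]
    (φ : Sym2 V → Option L) (x : CCC.LPPoint V L) (hx : x.IsFeasible) (a : V → L) :
    (∀ K ∈ (CCC.lpCCC φ x a).support, CCC.IsChromaticClustering K) ∧
    CCC.expectation (CCC.lpCCC φ x a) (fun K => (CCC.cost φ K : ℝ)) ≤ 2.15 * x.objective φ ∧
    (x.IsOptimal φ → ∀ K : Finset (Finset V × L), CCC.IsChromaticClustering K →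
      CCC.expectation (CCC.lpCCC φ x a) (fun K' => (CCC.cost φ K' : ℝ)) ≤
        2.15 * (CCC.cost φ K : ℝ)) := by
  refine ⟨fun K hK => ?_, hx.expectation_cost_le, fun hopt K hK => ?_⟩
  · rw [CCC.lpCCC_eq, PMF.mem_support_map_iff] at hK
    obtain ⟨𝒞, h𝒞, rfl⟩ := hK
    exact CCC.isChromaticClustering_assemble hx fun c =>
      CCC.isClusteringOf_of_mem_support_lpPivot _ _ _ _ _
          (CCC.mem_support_of_mem_support_indep h𝒞 c)
  · refine hx.expectation_cost_le.trans (mul_le_mul_of_nonneg_left ?_ (by norm_num))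
    rw [← CCC.objective_integralPoint φ hK]
    exact hopt.2 _ (CCC.isFeasible_integralPoint hK)
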